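/- **Relative entropy bound for linear advection (inviscid case).** Let $T>0$, $b\in\mathbb R$, $\Omega=(0,1)$. Consider the linear advection equation $$\partial_t u + b\,\partial_x u = 0 \quad\text{in } (0,T)\times\Omega, \tag{1}$$ and, for a residual $r_1\in L^1(0,T;L^2(\Omega))$, the perturbed equation $$\partial_t \hat u + b\,\partial_x \hat u = r_1 \quad\text{in } (0,T)\times\Omega. \tag{2}$$ Let $g_D:(0,T)\to\mathbb R$ be Lipschitz continuous. It serves as Dirichlet data on the inflow boundary, which is $\{x=0\}$ if $b>0$, $\{x=1\}$ if $b<0$, and empty if $b=0$ (in which case no boundary condition is imposed). Let $u_0\in L^\infty(\Omega)$ and let $u\in L^\infty((0,T)\times\Omega)$ be an entropy solution of (1) with initial data $u_0$ for the entropy/entropy-flux pair $\eta(u)=\tfrac12u^2$, $q(u)=\tfrac b2u^2$; that is, $$\int_0^T\!\!\int_\Omega \big(u\,\partial_t\phi + b\,u\,\partial_x\phi\big)\,dx\,dt+\int_\Omega u_0\,\phi(0,\cdot)\,dx=0\qquad\text{for all }\phi\in C_0^\infty([0,T)\times\Omega),$$ $$\int_0^T\!\!\int_\Omega \big(\eta(u)\,\partial_t\Phi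 + q(u)\,\partial_x\Phi\big)\,dx\,dt+\int_\Omega \eta(u_0)\,\Phi(0,\cdot)\,dx\ge 0\qquad\text{for all }\Phi\in C_0^\infty([0,T)\times\Omega),\ \Phi\ge0.$$ Suppose that $u$ attains the data $g_D$ on the inflow boundary as a weak trace: if $x_{\rm in}\in\{0,1\}$ denotes the inflow endpoint (when $b\ne0$), then $\operatorname{ess\,lim}_{x\to x_{\rm in},\,x\in\Omega}\int_0^T u(t,x)\psi(t)\,dt=\int_0^T g_D(t)\psi(t)\,dt$ for all $\psi\in C_0^\infty((0,T))$. Let $\hat u_0\in W^{1,\infty}(\Omega)$ and let $\hat u\in W^{1,\infty}((0,T)\times\Omega)$ (identified with its Lipschitz continuous representative on $[0,T]\times[0,1]$) satisfy (2) almost everywhere, with $\hat u(0,\cdot)=\hat u_0$ and with the same boundary values $\hat u(\cdot,x_{\rm in})=g_D$ on the inflow boundary. Then for almost all $t\in(0,T)$, $$\frac14\,\|u-\hat u\|_{L^\infty(0,t;L^2(\Omega))}^2\;\le\;\|u_0-\hat u_0\|_{L^2(\Omega)}^2+\|r_1\|_{L^1(0,t;L^2(\Omega))}^2 .$$ -/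

import Mathlib

open Set Filter MeasureTheory Topology
open scoped ENNReal NNReal ContDiff

namespace InviscidAdvection

/-- The spatial domain `Ω = (0,1)`. -/
def Omega : Set ℝ := Ioo 0 1

/-- The space-time cylinder `(0,T) × Ω`; points are written `(t, x)`. -/
def cylinder (T : ℝ) : Set (ℝ × ℝ) := Ioo 0 T ×ˢ Omega

/-- Test functions in `C_0^∞([0,T) × Ω)`: (restrictions to `t ≥ 0` of) smooth functions on `ℝ × ℝ`
with compact support in `(-∞,T) × Ω`. They need not vanish at `t = 0`, but vanish near `t = T` and
near `∂Ω`. -/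
structure IsTestFunction (T : ℝ) (φ : ℝ × ℝ → ℝ) : Prop where
  smooth : ContDiff ℝ ∞ φ
  hasCompactSupport : HasCompactSupport φ
  tsupport_subset : tsupport φ ⊆ Iio T ×ˢ Omega

/-- The partial derivative `∂_t φ`. -/
noncomputable def dt (φ : ℝ × ℝ → ℝ) (p : ℝ × ℝ) : ℝ := fderiv ℝ φ p (1, 0)

/-- The partial derivative `∂_x φ`. -/
noncomputable def dx (φ : ℝ × ℝ → ℝ) (p : ℝ × ℝ) : ℝ := fderiv ℝ φ p (0, 1)

/-- `u ∈ L^∞((0,T) × Ω)` is a weak solution of the scalar inviscid conservation law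
`∂_t u + ∂_x f(u) = 0` with initial data `u₀`. -/
structure IsWeakSolution (T : ℝ) (f : ℝ → ℝ) (u₀ : ℝ → ℝ) (u : ℝ × ℝ → ℝ) : Prop where
  memLp_top : MemLp u ∞ (volume.restrict (cylinder T))
  weak_form : ∀ φ : ℝ × ℝ → ℝ, IsTestFunction T φ →
    (∫ p in cylinder T, (dt φ p * u p + dx φ p * f (u p)))
      + ∫ x in Omega, u₀ x * φ (0, x) = 0

/-- `u` is an entropy solution of `∂_t u + ∂_x f(u) = 0` with initial data `u₀`, with respect to
the entropy/entropy-flux pair `(η, q)`: a weak solution which satisfies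
`∂_t η(u) + ∂_x q(u) ≤ 0` weakly, including the initial time. -/
structure IsEntropySolution (T : ℝ) (f η q : ℝ → ℝ) (u₀ : ℝ → ℝ) (u : ℝ × ℝ → ℝ) : Prop
    extends IsWeakSolution T f u₀ u where
  entropy_ineq : ∀ Φ : ℝ × ℝ → ℝ, IsTestFunction T Φ → (∀ t x, 0 ≤ t → 0 ≤ Φ (t, x)) →
    0 ≤ (∫ p in cylinder T, (dt Φ p * η (u p) + dx Φ p * q (u p)))
      + ∫ x in Omega, Φ (0, x) * η (u₀ x)

/-- `u(·,x) → g` in the sense of distributions on `(0,T)`, as `x` tends along `l`, the limit being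
an essential limit (null sets of `x` are disregarded). -/
def HasWeakTrace (T : ℝ) (l : Filter ℝ) (u : ℝ × ℝ → ℝ) (g : ℝ → ℝ) : Prop :=
  ∀ ψ : ℝ → ℝ, ContDiff ℝ ∞ ψ → HasCompactSupport ψ → tsupport ψ ⊆ Ioo 0 T →
    Tendsto (fun x => ∫ t in Ioo 0 T, u (t, x) * ψ t) (l ⊓ ae volume)
      (𝓝 (∫ t in Ioo 0 T, g t * ψ t))

/-- `u ∈ L^∞((0,T) × Ω)` attains the Dirichlet data `g` on the inflow boundary for the velocity
`b`: the left endpoint if `b > 0`, the right endpoint if `b < 0`, and nothing if `b = 0`. -/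
def AttainsInflowData (T b : ℝ) (u : ℝ × ℝ → ℝ) (g : ℝ → ℝ) : Prop :=
  (0 < b → HasWeakTrace T (𝓝[>] 0) u g) ∧ (b < 0 → HasWeakTrace T (𝓝[<] 1) u g)

/-- `v ∈ W^{1,∞}((0,T) × Ω)`, represented by its Lipschitz extension to the closed rectangle, is a
strong (almost everywhere) solution of `∂_t v + ∂_x f(v) = r` with initial data `v₀`. -/
structure IsLipschitzSolution (T : ℝ) (f : ℝ → ℝ) (r : ℝ × ℝ → ℝ) (v₀ : ℝ → ℝ)
    (v : ℝ × ℝ → ℝ) : Prop where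
  lipschitz : ∃ K : ℝ≥0, LipschitzOnWith K v (Icc 0 T ×ˢ Icc 0 1)
  equation : ∀ᵐ p ∂(volume.restrict (cylinder T)), ∃ v_t fv_x : ℝ,
    HasDerivAt (fun t => v (t, p.2)) v_t p.1 ∧
    HasDerivAt (fun x => f (v (p.1, x))) fv_x p.2 ∧
    v_t + fv_x = r p
  initial : ∀ x ∈ Omega, v (0, x) = v₀ x

/-- Pointwise version of the inflow Dirichlet condition, for functions that are continuous on the
closed rectangle. -/
def AttainsInflowDataPointwise (T b : ℝ) (v : ℝ × ℝ → ℝ) (g : ℝ → ℝ) : Prop :=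
  (0 < b → ∀ t ∈ Ioo 0 T, v (t, 0) = g t) ∧ (b < 0 → ∀ t ∈ Ioo 0 T, v (t, 1) = g t)

/-- The norm of `L²(Ω)`, with values in `[0,∞]`. -/
noncomputable def normL2 (w : ℝ → ℝ) : ℝ≥0∞ := eLpNorm w 2 (volume.restrict Omega)

/-- The norm of `L¹(0,t; L²(Ω))`, with values in `[0,∞]`. -/
noncomputable def normL1L2 (t : ℝ) (w : ℝ × ℝ → ℝ) : ℝ≥0∞ :=
  ∫⁻ s in Ioo 0 t, normL2 (fun x => w (s, x))

/-- The norm of `L^∞(0,t; L²(Ω))`, with values in `[0,∞]`. -/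
noncomputable def normLinftyL2 (t : ℝ) (w : ℝ × ℝ → ℝ) : ℝ≥0∞ :=
  essSup (fun s => normL2 (fun x => w (s, x))) (volume.restrict (Ioo 0 t))

/-- Membership in `L¹(0,T; L²(Ω))`. -/
def MemL1L2 (T : ℝ) (w : ℝ × ℝ → ℝ) : Prop :=
  AEStronglyMeasurable w (volume.restrict (cylinder T)) ∧ normL1L2 T w < (⊤ : ℝ≥0∞)

end InviscidAdvection

/-! The equation is linear, so the proof follows characteristics `x - b t = const` instead of
manipulating entropies. A bounded weak solution is constant along almost every characteristic: it
equals the initial data where the backward characteristic reaches `t = 0` inside `Omega`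
(`ae_eq_initial`), and the weak trace where it leaves through the inflow endpoint (`ae_eq_inflow`).
Both follow by testing with products of a function of the parameter along characteristics and a
function constant along them.

The Lipschitz function `uhat` changes along characteristics by the integral of `r₁`
(`ae_sub_eq_integral_along_characteristic`). Since the boundary values agree, the error at `(t, x)`
is at most the transported initial error plus the residual accumulated along the characteristic
(`ae_enorm_sub_le`). Translation invariance of the `L²` norm and Minkowski's integral inequality
(`normL2_le_of_ae_enorm_le`) give `‖(u - uhat)(t)‖ ≤ ‖u₀ - uhat₀‖ + ‖r₁‖_{L¹(0,t;L²)}`, which is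
stronger than the claim after squaring. -/

namespace InviscidAdvection

/-! ### Measure-theoretic tools. -/

/-- **Minkowski's integral inequality** in `L²`. -/
theorem eLpNorm_two_lintegral_le {α β : Type*} [MeasurableSpace α] [MeasurableSpace β]
    {μ : Measure α} {ν : Measure β} [SFinite μ] [SFinite ν] {f : α → β → ℝ≥0∞}
    (hf : Measurable (Function.uncurry f)) :
    eLpNorm (fun x => ∫⁻ s, f s x ∂μ) 2 ν ≤ ∫⁻ s, eLpNorm (f s) 2 ν ∂μ := by
  have key : ∀ h : β → ℝ≥0∞, eLpNorm h 2 ν = (∫⁻ x, h x ^ (2 : ℝ) ∂ν) ^ (1 / 2 : ℝ) := by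
    intro h
    rw [eLpNorm_eq_lintegral_rpow_enorm_toReal (by norm_num) (by norm_num)]
    simp
  have hfs : ∀ s, Measurable (f s) := fun s => hf.comp measurable_prodMk_left
  have hfx : ∀ x, Measurable (fun s => f s x) := fun x => hf.comp measurable_prodMk_right
  have hg : Measurable fun s => eLpNorm (f s) 2 ν := by
    simp_rw [key]
    exact (Measurable.lintegral_prod_right' (f := fun p : α × β => f p.1 p.2 ^ (2 : ℝ))
      (hf.pow_const _)).pow_const _
  have hI : Measurable fun x => ∫⁻ s, f s x ∂μ :=
    Measurable.lintegral_prod_left' (f := fun p : α × β => f p.1 p.2) hf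
  -- Write the square as a double integral, apply Tonelli, then Cauchy–Schwarz for each pair `s,
  -- s'`. Nothing is divided out, so infinite values need no separate case.
  have h1 : ∫⁻ x, (∫⁻ s, f s x ∂μ) ^ (2 : ℝ) ∂ν ≤ (∫⁻ s, eLpNorm (f s) 2 ν ∂μ) ^ (2 : ℝ) :=
    calc ∫⁻ x, (∫⁻ s, f s x ∂μ) ^ (2 : ℝ) ∂ν
        = ∫⁻ x, ∫⁻ s, f s x * (∫⁻ s', f s' x ∂μ) ∂μ ∂ν := by
          refine lintegral_congr fun x => ?_
          rw [lintegral_mul_const _ (hfx x), ENNReal.rpow_two, sq]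
      _ = ∫⁻ s, ∫⁻ x, f s x * (∫⁻ s', f s' x ∂μ) ∂ν ∂μ := by
          refine lintegral_lintegral_swap ?_
          exact ((hf.comp measurable_swap).mul (hI.comp measurable_fst)).aemeasurable
      _ = ∫⁻ s, ∫⁻ s', ∫⁻ x, f s x * f s' x ∂ν ∂μ ∂μ := by
          refine lintegral_congr fun s => ?_
          rw [← lintegral_lintegral_swap]
          · exact lintegral_congr fun x => (lintegral_const_mul _ (hfx x)).symm
          · exact (((hfs s).comp measurable_fst).mul (hf.comp measurable_swap)).aemeasurable
      _ ≤ ∫⁻ s, ∫⁻ s', eLpNorm (f s) 2 ν * eLpNorm (f s') 2 ν ∂μ ∂μ := by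
          refine lintegral_mono fun s => lintegral_mono fun s' => ?_
          rw [key, key]
          exact ENNReal.lintegral_mul_le_Lp_mul_Lq ν Real.HolderConjugate.two_two
            (hfs s).aemeasurable (hfs s').aemeasurable
      _ = (∫⁻ s, eLpNorm (f s) 2 ν ∂μ) ^ (2 : ℝ) := by
          simp_rw [lintegral_const_mul _ hg]
          rw [lintegral_mul_const _ hg, ENNReal.rpow_two, sq]
  rw [key]
  refine (ENNReal.rpow_le_rpow h1 (by norm_num)).trans_eq ?_
  rw [← ENNReal.rpow_mul]
  norm_num

/-- A function whose weak derivative vanishes on an interval is almost everywhere constant there. -/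
theorem ae_eq_const_of_integral_mul_deriv_eq_zero {M : ℝ → ℝ} {a c : ℝ}
    (hM : LocallyIntegrable M)
    (h : ∀ A : ℝ → ℝ, ContDiff ℝ ∞ A → HasCompactSupport A → tsupport A ⊆ Ioo a c →
      ∫ t, deriv A t * M t = 0) :
    ∃ m, ∀ᵐ t, t ∈ Ioo a c → M t = m := by
  rcases le_or_gt c a with hac | hac
  · exact ⟨0, .of_forall fun t ht => absurd (ht.1.trans ht.2) hac.not_gt⟩
  obtain ⟨A₀, hA₀, hA₀c, hA₀s, hA₀i⟩ : ∃ A₀ : ℝ → ℝ, ContDiff ℝ ∞ A₀ ∧ HasCompactSupport A₀ ∧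
      tsupport A₀ ⊆ Ioo a c ∧ ∫ t, A₀ t = 1 := by
    let B : ContDiffBump ((a + c) / 2) := ⟨(c - a) / 8, (c - a) / 4, by linarith, by linarith⟩
    refine ⟨B.normed volume, B.contDiff_normed, B.hasCompactSupport_normed, ?_,
      B.integral_normed⟩
    rw [B.tsupport_normed_eq, Real.closedBall_eq_Icc]
    intro x hx
    have h1 : B.rOut = (c - a) / 4 := rfl
    rw [h1] at hx
    exact ⟨by linarith [hx.1], by linarith [hx.2]⟩
  refine ⟨∫ t, A₀ t * M t, ?_⟩
  have key : ∀ᵐ t, t ∈ Ioo a c → M t - ∫ s, A₀ s * M s = 0 := by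
    refine isOpen_Ioo.ae_eq_zero_of_integral_contDiff_smul_eq_zero
      ((hM.sub (locallyIntegrable_const _)).locallyIntegrableOn _) fun ψ hψ hψc hψs => ?_
    -- Subtracting a multiple of the unit-mass bump `A₀` gives `θ` mean zero, so its primitive `A`
    -- has compact support and is an admissible test function.
    set θ : ℝ → ℝ := fun t => ψ t - (∫ s, ψ s) * A₀ t with hθ
    have iψ : Integrable ψ := hψ.continuous.integrable_of_hasCompactSupport hψc
    have iA₀ : Integrable A₀ := hA₀.continuous.integrable_of_hasCompactSupport hA₀c
    have hθd : ContDiff ℝ ∞ θ := hψ.sub (contDiff_const.mul hA₀)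
    have hθi : ∫ t, θ t = 0 := by
      rw [integral_sub iψ (iA₀.const_mul _), integral_const_mul, hA₀i]; ring
    have hK : IsCompact (tsupport ψ ∪ tsupport A₀) := hψc.isCompact.union hA₀c.isCompact
    have hKs : tsupport ψ ∪ tsupport A₀ ⊆ Ioo a c := union_subset hψs hA₀s
    obtain ⟨a', c', ha', hc', hK'⟩ : ∃ a' c', a < a' ∧ c' < c ∧
        tsupport ψ ∪ tsupport A₀ ⊆ Ioo a' c' := by
      rcases (tsupport ψ ∪ tsupport A₀).eq_empty_or_nonempty with he | hne
      · exact ⟨(a + c) / 2, (a + c) / 2, by linarith, by linarith, by simp [he]⟩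
      · have h1 := hKs (hK.sInf_mem hne)
        have h2 := hKs (hK.sSup_mem hne)
        refine ⟨(a + sInf (tsupport ψ ∪ tsupport A₀)) / 2,
          (sSup (tsupport ψ ∪ tsupport A₀) + c) / 2, by linarith [h1.1], by linarith [h2.2], ?_⟩
        intro x hx
        have h3 := csInf_le hK.bddBelow hx
        have h4 := le_csSup hK.bddAbove hx
        exact ⟨by linarith [h1.1], by linarith [h2.2]⟩
    have hθ0 : ∀ t, t ∉ Ioo a' c' → θ t = 0 := by
      intro t ht
      have h1 : t ∉ tsupport ψ := fun h => ht (hK' (Or.inl h))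
      have h2 : t ∉ tsupport A₀ := fun h => ht (hK' (Or.inr h))
      simp [hθ, image_eq_zero_of_notMem_tsupport h1, image_eq_zero_of_notMem_tsupport h2]
    set A : ℝ → ℝ := fun t => ∫ s in a'..t, θ s with hA
    have hAd : ∀ t, HasDerivAt A (θ t) t := fun t =>
      intervalIntegral.integral_hasDerivAt_right (hθd.continuous.intervalIntegrable _ _)
        (hθd.continuous.stronglyMeasurableAtFilter _ _) hθd.continuous.continuousAt
    have hAs : ∀ t, t ∉ Icc a' c' → A t = 0 := by
      intro t ht
      rcases lt_or_ge t a' with h1 | h1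
      · simp only [hA]
        rw [intervalIntegral.integral_congr (g := fun _ => 0), intervalIntegral.integral_zero]
        intro s hs
        rw [uIcc_of_ge h1.le] at hs
        exact hθ0 s fun h => absurd h.1 hs.2.not_gt
      · have h2 : c' < t := by
          by_contra h2
          exact ht ⟨h1, not_lt.1 h2⟩
        simp only [hA]
        rw [intervalIntegral.integral_eq_integral_of_support_subset, hθi]
        intro s hs
        by_contra h3
        exact hs (hθ0 s fun h => h3 ⟨h.1, h.2.le.trans h2.le⟩)
    have hder : deriv A = θ := funext fun t => (hAd t).deriv
    have hAsm : ContDiff ℝ ∞ A := by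
      rw [contDiff_infty_iff_deriv]
      exact ⟨fun t => (hAd t).differentiableAt, hder ▸ hθd⟩
    have hts : tsupport A ⊆ Icc a' c' :=
      closure_minimal (fun t ht => by by_contra h; exact ht (hAs t h)) isClosed_Icc
    have h0 := h A hAsm (HasCompactSupport.of_support_subset_isCompact isCompact_Icc
      ((subset_tsupport A).trans hts)) (hts.trans (Icc_subset_Ioo ha' hc'))
    rw [hder] at h0
    have iψM : Integrable (fun t => ψ t * M t) := by
      simpa using hM.integrable_smul_left_of_hasCompactSupport hψ.continuous hψc
    have iAM : Integrable (fun t => A₀ t * M t) := by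
      simpa using hM.integrable_smul_left_of_hasCompactSupport hA₀.continuous hA₀c
    have e1 : ∀ t, θ t * M t = ψ t * M t - (∫ s, ψ s) * (A₀ t * M t) := fun t => by
      simp only [hθ]; ring
    simp_rw [e1] at h0
    rw [integral_sub iψM (iAM.const_mul _), integral_const_mul] at h0
    simp only [smul_eq_mul, mul_sub]
    rw [integral_sub iψM (iψ.mul_const _), integral_mul_const]
    exact h0
  filter_upwards [key] with t ht htm
  linarith [ht htm]

/-- A bounded measurable function of two variables which, for almost every value of the first one,
is orthogonal to all test functions of the second one, vanishes almost everywhere. -/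
theorem ae_eq_zero_on_prod_of_forall_test {F : ℝ → ℝ → ℝ} {C : ℝ}
    (hF : Measurable (Function.uncurry F)) (hC : ∀ s y, |F s y| ≤ C) {I J : Set ℝ}
    (hI : IsOpen I) (hJ : IsOpen J)
    (h : ∀ β : ℝ → ℝ, ContDiff ℝ ∞ β → HasCompactSupport β → tsupport β ⊆ J →
      ∀ᵐ s, s ∈ I → ∫ y, F s y * β y = 0) :
    ∀ᵐ p : ℝ × ℝ, p ∈ I ×ˢ J → F p.1 p.2 = 0 := by
  have hbdd : ∀ S S' : Set ℝ, MeasurableSet S → MeasurableSet S' → volume S < ⊤ → volume S' < ⊤ →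
      IntegrableOn (Function.uncurry F) (S ×ˢ S') (volume.prod volume) := by
    intro S S' hS hS' h1 h2
    refine Measure.integrableOn_of_bounded (M := C) ?_ hF.aestronglyMeasurable
      (.of_forall fun p => hC p.1 p.2)
    rw [Measure.prod_prod]
    exact (ENNReal.mul_lt_top h1 h2).ne
  have key : ∀ S S' : Set ℝ, MeasurableSet S → MeasurableSet S' → volume S < ⊤ → volume S' < ⊤ →
      S ⊆ I → S' ⊆ J → ∫ p in S ×ˢ S', F p.1 p.2 = 0 := by
    intro S S' hS hS' hSf hS'f hSI hS'J
    -- The exceptional null set of `s` depends on `β`. Integrating over `s ∈ S` first removes this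
    -- dependence, and the fundamental lemma then applies in `y` alone.
    have hG : ∀ᵐ y, y ∈ J → ∫ s in S, F s y = 0 := by
      have : IsFiniteMeasure (volume.restrict S) := ⟨by simpa using hSf⟩
      have hGm : StronglyMeasurable (fun y => ∫ s in S, F s y) :=
        StronglyMeasurable.integral_prod_right (f := fun y s => F s y)
          (hF.comp measurable_swap).stronglyMeasurable
      refine hJ.ae_eq_zero_of_integral_contDiff_smul_eq_zero
        (LocallyIntegrable.locallyIntegrableOn ?_ _) fun β hβ hβc hβs => ?_
      · refine (memLp_top_of_bound hGm.aestronglyMeasurable (C * (volume S).toReal)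
          (.of_forall fun y => ?_)).locallyIntegrable (by simp)
        exact norm_setIntegral_le_of_norm_le_const hSf (fun s _ => hC s y)
      · have hint : Integrable (Function.uncurry fun s y => F s y * β y)
            ((volume.restrict S).prod volume) := by
          have : Integrable (fun p : ℝ × ℝ => (1 : ℝ) * β p.2) ((volume.restrict S).prod volume) :=
            (integrable_const (1:ℝ)).mul_prod (hβ.continuous.integrable_of_hasCompactSupport hβc)
          simp only [one_mul] at this
          exact this.bdd_mul hF.aestronglyMeasurable (.of_forall fun p => hC p.1 p.2)
        have := integral_integral_swap hint
        simp_rw [integral_mul_const] at this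
        simp_rw [smul_eq_mul, mul_comm (β _)]
        rw [← this]
        rw [setIntegral_congr_ae (g := fun _ => 0) hS]
        · simp
        · filter_upwards [h β hβ hβc hβs] with s hs hsS using hs (hSI hsS)
    have hi := hbdd S S' hS hS' hSf hS'f
    rw [IntegrableOn, ← Measure.prod_restrict] at hi
    rw [Measure.volume_eq_prod, ← Measure.prod_restrict,
      integral_prod_symm (fun p : ℝ × ℝ => F p.1 p.2) hi,
      setIntegral_congr_ae (g := fun _ => 0) hS']
    · simp
    · filter_upwards [hG] with y hy hyS using hy (hS'J hyS)
  have hloc : LocallyIntegrable (Function.uncurry F) (volume : Measure (ℝ × ℝ)) :=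
    (memLp_top_of_bound hF.aestronglyMeasurable C
      (.of_forall fun p => hC p.1 p.2)).locallyIntegrable (by simp)
  -- Lebesgue differentiation: closed balls of the sup metric are squares, over which the integral
  -- of `F` vanishes by `key`.
  filter_upwards [IsUnifLocDoublingMeasure.ae_tendsto_average volume hloc 1] with p hp hpIJ
  have hδ : Tendsto (fun δ : ℝ => δ) (𝓝[>] 0) (𝓝[>] 0) := tendsto_id
  have h1 := hp (fun _ : ℝ => p) (fun δ => δ) hδ
    (by filter_upwards [self_mem_nhdsWithin] with δ hδ; simpa using le_of_lt hδ)
  have h2 : ∀ᶠ δ in 𝓝[>] (0 : ℝ), ⨍ y in Metric.closedBall p δ, Function.uncurry F y = 0 := by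
    obtain ⟨ε, hε, hεs⟩ := Metric.isOpen_iff.1 (hI.prod hJ) p hpIJ
    filter_upwards [Ioo_mem_nhdsGT hε] with δ hδ
    have h3 : Metric.closedBall p.1 δ ×ˢ Metric.closedBall p.2 δ ⊆ I ×ˢ J := by
      rw [closedBall_prod_same]
      exact (Metric.closedBall_subset_ball hδ.2).trans hεs
    have h4 := prod_subset_prod_iff.1 h3
    have hpos := hδ.1.le
    rw [setAverage_eq, ← closedBall_prod_same]
    rcases h4 with h4 | h4 | h4
    · have := key (Metric.closedBall p.1 δ) (Metric.closedBall p.2 δ) measurableSet_closedBall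
        measurableSet_closedBall measure_closedBall_lt_top measure_closedBall_lt_top h4.1 h4.2
      simp only [Function.uncurry_def]
      rw [this, smul_zero]
    · simp [h4]
    · simp [h4]
  exact tendsto_nhds_unique h1 (tendsto_const_nhds.congr' (h2.mono fun _ h => h.symm))


/-! ### Lipschitz functions along characteristics. -/

theorem measurePreserving_shear (b : ℝ) :
    MeasurePreserving (fun p : ℝ × ℝ => (p.1, p.2 - b * p.1)) := by
  refine (MeasurePreserving.id volume).skew_product (g := fun t x : ℝ => x - b * t)
    (by fun_prop) (.of_forall fun t => ?_)
  exact (measurePreserving_sub_right volume (b * t)).map_eq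

/-- A Lipschitz function is recovered along almost every characteristic from its derivative in the
direction of the characteristic. -/
theorem ae_sub_eq_integral_along_characteristic {K : ℝ≥0} {v : ℝ × ℝ → ℝ} (hv : LipschitzWith K v)
    (b : ℝ) :
    ∀ᵐ p : ℝ × ℝ, ∀ s, v p - v (s, p.2 - b * (p.1 - s)) =
      ∫ r in s..p.1, fderiv ℝ v (r, p.2 - b * (p.1 - r)) (1, b) := by
  -- Rademacher's theorem, pulled back by the shear: by Fubini, almost every characteristic meets
  -- the non-differentiability set in a null set of times, and the fundamental theorem of calculus
  -- applies along it.
  have h1 : ∀ᵐ q : ℝ × ℝ, DifferentiableAt ℝ v (q.1, q.2 - -b * q.1) :=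
    (measurePreserving_shear (-b)).quasiMeasurePreserving.ae hv.ae_differentiableAt
  rw [Measure.volume_eq_prod] at h1
  have h2 : ∀ᵐ y : ℝ, ∀ᵐ t : ℝ, DifferentiableAt ℝ v (t, y - -b * t) :=
    Measure.ae_ae_of_ae_prod
      (Measure.measurePreserving_swap.quasiMeasurePreserving.ae h1 :
        ∀ᵐ q : ℝ × ℝ ∂(volume.prod volume), DifferentiableAt ℝ v (q.2, q.1 - -b * q.2))
  have h3 : ∀ᵐ y : ℝ, ∀ s t, v (t, y + b * t) - v (s, y + b * s) =
      ∫ r in s..t, fderiv ℝ v (r, y + b * r) (1, b) := by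
    filter_upwards [h2] with y hy s t
    have hlip : LipschitzWith (K * (1 + ‖b‖₊)) (fun r => v (r, y + b * r)) := by
      refine hv.comp (LipschitzWith.of_dist_le_mul fun r r' => ?_)
      rw [Prod.dist_eq]
      simp only [Real.dist_eq, NNReal.coe_add, NNReal.coe_one, coe_nnnorm, Real.norm_eq_abs]
      have : y + b * r - (y + b * r') = b * (r - r') := by ring
      rw [this, abs_mul]
      refine max_le ?_ ?_ <;> nlinarith [abs_nonneg b, abs_nonneg (r - r')]
    have hac := (hlip.lipschitzOnWith (s := uIcc s t)).absolutelyContinuousOnInterval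
    rw [← hac.integral_deriv_eq_sub]
    refine intervalIntegral.integral_congr_ae ?_
    filter_upwards [hy] with r hr _
    have h4 : HasDerivAt (fun r => (r, y + b * r)) ((1 : ℝ), b) r := by
      refine (hasDerivAt_id r).prodMk ?_
      simpa using ((hasDerivAt_id r).const_mul b).const_add y
    have h5 : y - -b * r = y + b * r := by ring
    rw [h5] at hr
    exact (hr.hasFDerivAt.comp_hasDerivAt r h4).deriv
  have h4 : ∀ᵐ p : ℝ × ℝ, ∀ s t, v (t, p.2 - b * p.1 + b * t) - v (s, p.2 - b * p.1 + b * s) =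
      ∫ r in s..t, fderiv ℝ v (r, p.2 - b * p.1 + b * r) (1, b) :=
    (Measure.quasiMeasurePreserving_snd.comp
      (measurePreserving_shear b).quasiMeasurePreserving).ae h3
  filter_upwards [h4] with p hp s
  have := hp s p.1
  have e : ∀ r, p.2 - b * (p.1 - r) = p.2 - b * p.1 + b * r := fun r => by ring
  simp_rw [e]
  rw [← this]
  simp

/-! ### Product test functions in characteristic coordinates. -/

section TestFunctions

variable {T b : ℝ} {A β : ℝ → ℝ} {L N : ℝ × ℝ → ℝ} {Ψ : ℝ × ℝ → ℝ × ℝ}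

/-- `Ψ` recovers a point from its characteristic coordinates `(L, N)`, so the support is controlled
by the `Ψ`-image of a compact product. -/
theorem tsupport_comp_mul_comp_subset (hA : HasCompactSupport A) (hβ : HasCompactSupport β)
    (hΨ : Continuous Ψ) (hΨL : ∀ p, Ψ (L p, N p) = p) :
    tsupport (fun p => A (L p) * β (N p)) ⊆ Ψ '' (tsupport A ×ˢ tsupport β) := by
  refine closure_minimal (fun p hp => ⟨(L p, N p), ⟨?_, ?_⟩, hΨL p⟩)
    ((hA.isCompact.prod hβ.isCompact).image hΨ).isClosed
  · exact subset_tsupport _ (left_ne_zero_of_mul hp)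
  · exact subset_tsupport _ (right_ne_zero_of_mul hp)

theorem hasCompactSupport_comp_mul_comp (hA : HasCompactSupport A) (hβ : HasCompactSupport β)
    (hΨ : Continuous Ψ) (hΨL : ∀ p, Ψ (L p, N p) = p) :
    HasCompactSupport (fun p => A (L p) * β (N p)) :=
  ((hA.isCompact.prod hβ.isCompact).image hΨ).of_isClosed_subset (isClosed_tsupport _)
    (tsupport_comp_mul_comp_subset hA hβ hΨ hΨL)

theorem IsTestFunction.comp_mul_comp (hAs : ContDiff ℝ ∞ A) (hA : HasCompactSupport A)
    (hβs : ContDiff ℝ ∞ β) (hβ : HasCompactSupport β) (hL : ContDiff ℝ ∞ L) (hN : ContDiff ℝ ∞ N)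
    (hΨ : Continuous Ψ) (hΨL : ∀ p, Ψ (L p, N p) = p)
    (hsub : ∀ a ∈ tsupport A, ∀ c ∈ tsupport β, Ψ (a, c) ∈ Iio T ×ˢ Omega) :
    IsTestFunction T (fun p => A (L p) * β (N p)) where
  smooth := (hAs.comp hL).mul (hβs.comp hN)
  hasCompactSupport := hasCompactSupport_comp_mul_comp hA hβ hΨ hΨL
  tsupport_subset := (tsupport_comp_mul_comp_subset hA hβ hΨ hΨL).trans <| by
    rintro _ ⟨⟨a, c⟩, ⟨ha, hc⟩, rfl⟩
    exact hsub a ha c hc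

/-- Differentiation of a product test function in the characteristic direction `(1, b)`, when the
second factor is constant along characteristics. -/
theorem dt_mul_add_dx_mul_comp_mul_comp (hAs : ContDiff ℝ ∞ A) (hβs : ContDiff ℝ ∞ β)
    {L' N' : ℝ × ℝ →L[ℝ] ℝ} {p : ℝ × ℝ} (hL : HasFDerivAt L L' p) (hN : HasFDerivAt N N' p)
    (hL' : L' (1, b) = 1) (hN' : N' (1, b) = 0) (w : ℝ) :
    dt (fun p => A (L p) * β (N p)) p * w + dx (fun p => A (L p) * β (N p)) p * (b * w)
      = deriv A (L p) * β (N p) * w := by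
  have hA : HasDerivAt A (deriv A (L p)) (L p) :=
    (hAs.differentiable (by simp)).differentiableAt.hasDerivAt
  have hβ : HasDerivAt β (deriv β (N p)) (N p) :=
    (hβs.differentiable (by simp)).differentiableAt.hasDerivAt
  have h := (hA.comp_hasFDerivAt p hL).mul (hβ.comp_hasFDerivAt p hN)
  have h1 : fderiv ℝ (fun p => A (L p) * β (N p)) p = _ := h.fderiv
  have h2 : ((1 : ℝ), b) = (1, 0) + b • (0, 1) := by simp
  rw [h2, map_add, map_smul, smul_eq_mul] at hL' hN'
  simp only [dt, dx, h1]
  simp only [add_apply, smul_apply, smul_eq_mul,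
    Function.comp_apply]
  linear_combination (A (L p) * deriv β (N p) * w) * hN' + (β (N p) * deriv A (L p) * w) * hL'

end TestFunctions

theorem abs_integral_mul_le {F β : ℝ → ℝ} {C : ℝ} (hC : ∀ y, |F y| ≤ C)
    (hβ : Integrable β) : |∫ y, F y * β y| ≤ C * ∫ y, |β y| := by
  rw [← integral_const_mul]
  refine norm_integral_le_of_norm_le (f := fun y => F y * β y) (hβ.abs.const_mul C)
    (.of_forall fun y => ?_)
  rw [norm_mul]
  exact mul_le_mul_of_nonneg_right (hC y) (abs_nonneg _)

theorem locallyIntegrable_integral_mul {F : ℝ → ℝ → ℝ} {C : ℝ}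
    (hF : Measurable (Function.uncurry F)) (hC : ∀ s y, |F s y| ≤ C) {β : ℝ → ℝ}
    (hβm : Measurable β) (hβ : Integrable β) :
    LocallyIntegrable (fun s => ∫ y, F s y * β y) := by
  have hm : StronglyMeasurable (fun s => ∫ y, F s y * β y) :=
    StronglyMeasurable.integral_prod_right (f := fun s y => F s y * β y)
      (hF.mul (hβm.comp measurable_snd)).stronglyMeasurable
  exact (memLp_top_of_bound hm.aestronglyMeasurable _
    (.of_forall fun s => abs_integral_mul_le (hC s) hβ)).locallyIntegrable (by simp)


/-! ### Transport from the initial data. -/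

theorem measurableSet_cylinder (T : ℝ) : MeasurableSet (cylinder T) :=
  measurableSet_Ioo.prod measurableSet_Ioo

theorem volume_cylinder_lt_top (T : ℝ) : volume (cylinder T) < ⊤ := by
  rw [cylinder, Measure.volume_eq_prod, Measure.prod_prod, Omega]
  exact ENNReal.mul_lt_top (by simp) (by simp)

/-- A locally null set in the plane is null. This passes from small rectangles in characteristic
coordinates to the whole region covered by one family of characteristics. -/
theorem ae_cylinder_of_forall_mem_nhds {P : ℝ × ℝ → Prop} {D : Set (ℝ × ℝ)}
    (h : ∀ p ∈ D, ∃ I J : Set ℝ, IsOpen I ∧ IsOpen J ∧ p ∈ I ×ˢ J ∧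
      ∀ᵐ q : ℝ × ℝ, q ∈ I ×ˢ J → P q) :
    ∀ᵐ p : ℝ × ℝ, p ∈ D → P p := by
  rw [ae_iff]
  have : {a | ¬ (a ∈ D → P a)} = D ∩ {a | ¬ P a} := by ext; simp
  rw [this]
  refine measure_null_of_locally_null _ fun p hp => ?_
  obtain ⟨I, J, hI, hJ, hpIJ, hq⟩ := h p hp.1
  refine ⟨_, inter_mem_nhdsWithin _ ((hI.prod hJ).mem_nhds hpIJ), ?_⟩
  rw [ae_iff] at hq
  refine measure_mono_null (fun q hq' => ?_) hq
  exact fun h' => hq'.1.2 (h' hq'.2)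

variable {T b C : ℝ} {U : ℝ × ℝ → ℝ}

/-- Away from the part of the cylinder reached from the lateral boundary, a weak solution is
transported from the initial data: local version. -/
theorem ae_eq_initial_on_prod {U₀ : ℝ → ℝ} (hUm : Measurable U) (hUC : ∀ p, |U p| ≤ C)
    (hU₀m : Measurable U₀) (hU₀C : ∀ x, |U₀ x| ≤ C)
    (hU : IsWeakSolution T (fun v => b * v) U₀ U) {t₀ t₁ : ℝ} {J : Set ℝ}
    (ht₀ : t₀ < 0) (ht₁ : t₁ ≤ T) (hJ : IsOpen J)
    (hIJ : ∀ t ∈ Ioo t₀ t₁, ∀ y ∈ J, y + b * t ∈ Omega) :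
    ∀ᵐ p : ℝ × ℝ, p ∈ Ioo 0 t₁ ×ˢ J → U (p.1, p.2 + b * p.1) - U₀ p.2 = 0 := by
  rcases le_or_gt t₁ 0 with ht₁0 | ht₁0
  · simp [Ioo_eq_empty ht₁0.not_gt]
  -- Extension by zero to negative times encodes the initial condition: the initial term of the weak
  -- formulation says exactly that the pairing `M` below has no jump at `0`, so it is constant on
  -- `(t₀, t₁)` and equals its value `0` for negative times.
  set F : ℝ → ℝ → ℝ := fun s y => if 0 < s then U (s, y + b * s) - U₀ y else 0 with hFdef
  have hFm : Measurable (Function.uncurry F) := by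
    refine Measurable.ite (measurableSet_lt measurable_const measurable_fst) ?_ measurable_const
    exact (hUm.comp (by fun_prop)).sub (hU₀m.comp measurable_snd)
  have hFC : ∀ s y, |F s y| ≤ 2 * C := by
    intro s y
    have h1 := hUC (s, y + b * s)
    have h2 := hU₀C y
    simp only [hFdef]
    split_ifs
    · exact (abs_sub _ _).trans (by linarith)
    · simpa using (abs_nonneg _).trans h2
  have main := ae_eq_zero_on_prod_of_forall_test hFm hFC (isOpen_Ioo (a := t₀) (b := t₁)) hJ ?_
  · filter_upwards [main] with p hp hpm
    have := hp ⟨⟨ht₀.trans hpm.1.1, hpm.1.2⟩, hpm.2⟩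
    simpa [hFdef, hpm.1.1] using this
  intro β hβ hβc hβJ
  have iβ : Integrable β := hβ.continuous.integrable_of_hasCompactSupport hβc
  set M : ℝ → ℝ := fun s => ∫ y, F s y * β y with hM
  have hM0 : ∀ s ≤ 0, M s = 0 := fun s hs => by simp [hM, hFdef, not_lt.2 hs]
  have hconst := ae_eq_const_of_integral_mul_deriv_eq_zero (M := M) (a := t₀) (c := t₁)
    (locallyIntegrable_integral_mul hFm hFC hβ.continuous.measurable iβ) ?_
  · obtain ⟨m, hm⟩ := hconst
    have hm0 : m = 0 := by
      by_contra hne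
      rw [ae_iff] at hm
      have : volume (Ioo t₀ 0) = 0 := by
        refine measure_mono_null (fun s hs => ?_) hm
        exact fun h => hne (by rw [← h ⟨hs.1, hs.2.trans ht₁0⟩, hM0 s hs.2.le])
      simp [ht₀.not_ge] at this
    filter_upwards [hm] with s hs hsI
    exact (hs hsI).trans hm0
  intro A hA hAc hAI
  have iA' : Integrable (deriv A) := (hA.continuous_deriv (by simp)).integrable_of_hasCompactSupport
    hAc.deriv
  have hA' : ∀ s, s ∉ Ioo t₀ t₁ → deriv A s = 0 := fun s hs =>
    image_eq_zero_of_notMem_tsupport fun h => hs (hAI (tsupport_deriv_subset h))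
  have hβ0 : ∀ y, y ∉ J → β y = 0 := fun y hy =>
    image_eq_zero_of_notMem_tsupport fun h => hy (hβJ h)
  set m₀ := ∫ y, U₀ y * β y with hm₀
  -- the weak formulation for the test function `A(t) β(x - b t)`
  have hΨL : ∀ p : ℝ × ℝ, (fun q : ℝ × ℝ => (q.1, q.2 + b * q.1)) (p.1, p.2 - b * p.1) = p := by
    intro p; ext <;> simp
  have hφ : IsTestFunction T (fun p => A p.1 * β (p.2 - b * p.1)) :=
    IsTestFunction.comp_mul_comp (L := fun p => p.1) (N := fun p => p.2 - b * p.1)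
      (Ψ := fun q => (q.1, q.2 + b * q.1)) hA hAc hβ hβc (by fun_prop) (by fun_prop) (by fun_prop)
      hΨL (fun a ha c hc => ⟨(hAI ha).2.trans_le ht₁, hIJ a (hAI ha) c (hβJ hc)⟩)
  have hw := hU.weak_form _ hφ
  have e1 : ∀ p : ℝ × ℝ, dt (fun p => A p.1 * β (p.2 - b * p.1)) p * U p
      + dx (fun p => A p.1 * β (p.2 - b * p.1)) p * (b * U p)
      = deriv A p.1 * β (p.2 - b * p.1) * U p := fun p =>
    dt_mul_add_dx_mul_comp_mul_comp (L := fun p => p.1) (N := fun p => p.2 - b * p.1) hA hβ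
      (L' := ContinuousLinearMap.fst ℝ ℝ ℝ)
      (N' := ContinuousLinearMap.snd ℝ ℝ ℝ - b • ContinuousLinearMap.fst ℝ ℝ ℝ)
      hasFDerivAt_fst (hasFDerivAt_snd.sub (hasFDerivAt_fst.const_mul b)) (by simp) (by simp) _
  simp_rw [e1] at hw
  have e2 : ∫ x in Omega, U₀ x * (A 0 * β (x - b * 0)) = A 0 * m₀ := by
    rw [setIntegral_eq_integral_of_forall_compl_eq_zero, hm₀, ← integral_const_mul]
    · refine integral_congr_ae (.of_forall fun x => ?_)
      simp only [mul_zero, sub_zero]; ring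
    · intro x hx
      rw [hβ0, mul_zero, mul_zero]
      intro hxJ
      have := hIJ 0 ⟨ht₀, ht₁0⟩ _ hxJ
      simp only [mul_zero, sub_zero, add_zero] at this
      exact hx this
  rw [e2] at hw
  have hint : IntegrableOn (fun p : ℝ × ℝ => deriv A p.1 * β (p.2 - b * p.1) * U p)
      (Ioo 0 T ×ˢ Omega) (volume.prod volume) := by
    have hc : HasCompactSupport fun p : ℝ × ℝ => deriv A p.1 * β (p.2 - b * p.1) :=
      hasCompactSupport_comp_mul_comp (L := fun p => p.1) (N := fun p => p.2 - b * p.1)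
        (Ψ := fun q => (q.1, q.2 + b * q.1)) hAc.deriv hβc (by fun_prop) hΨL
    have hcont : Continuous fun p : ℝ × ℝ => deriv A p.1 * β (p.2 - b * p.1) :=
      ((hA.continuous_deriv (by simp)).comp continuous_fst).mul (hβ.continuous.comp (by fun_prop))
    exact ((hcont.integrable_of_hasCompactSupport hc).mul_bdd hUm.aestronglyMeasurable
      (.of_forall hUC)).integrableOn
  rw [cylinder, Measure.volume_eq_prod, setIntegral_prod _ hint] at hw
  -- Substitute `y = x - b t`. For `t` in the window the translated support of `β` stays in `Omega`,
  -- so the integral may be taken over the whole line; for other `t` the factor `deriv A t`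
  -- vanishes.
  have e3 : ∀ t, ∫ x in Omega, deriv A t * β (x - b * t) * U (t, x)
      = deriv A t * ∫ y, U (t, y + b * t) * β y := by
    intro t
    by_cases ht : t ∈ Ioo t₀ t₁
    · rw [setIntegral_eq_integral_of_forall_compl_eq_zero,
        ← integral_add_right_eq_self _ (b * t), ← integral_const_mul]
      · refine integral_congr_ae (.of_forall fun x => ?_)
        simp only [add_sub_cancel_right]; ring
      · intro x hx
        rw [hβ0, mul_zero, zero_mul]
        intro hxJ
        have := hIJ t ht _ hxJ
        simp only [sub_add_cancel] at this
        exact hx this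
    · simp [hA' t ht]
  simp_rw [e3] at hw
  have e4 : ∫ t, deriv A t * M t = ∫ t in Ioi 0,
      (deriv A t * (∫ y, U (t, y + b * t) * β y) - deriv A t * m₀) := by
    rw [← setIntegral_eq_integral_of_forall_compl_eq_zero (s := Ioi 0)]
    · refine setIntegral_congr_fun measurableSet_Ioi fun t ht => ?_
      simp only [hM, hFdef, if_pos (mem_Ioi.1 ht)]
      rw [← mul_sub, hm₀, ← integral_sub]
      · simp_rw [sub_mul]
      · exact iβ.bdd_mul (hUm.comp (by fun_prop)).aestronglyMeasurable
          (.of_forall fun y => hUC _)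
      · exact iβ.bdd_mul hU₀m.aestronglyMeasurable (.of_forall hU₀C)
    · intro t ht
      rw [hM0 t (not_lt.1 ht), mul_zero]
  have iG : Integrable fun t => deriv A t * (∫ y, U (t, y + b * t) * β y) := by
    refine iA'.mul_bdd (c := C * ∫ y, |β y|) ?_
      (.of_forall fun t => abs_integral_mul_le (fun y => hUC _) iβ)
    refine (StronglyMeasurable.integral_prod_right (f := fun t y => U (t, y + b * t) * β y) ?_
      ).aestronglyMeasurable
    exact ((hUm.comp (by fun_prop)).mul
      (hβ.continuous.measurable.comp measurable_snd)).stronglyMeasurable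
  rw [e4, integral_sub iG.integrableOn (iA'.mul_const _).integrableOn, integral_mul_const,
    hAc.integral_Ioi_deriv_eq (hA.of_le (by simp)) 0,
    setIntegral_eq_of_subset_of_forall_sdiff_eq_zero measurableSet_Ioi
      (Ioo_subset_Ioi_self : Ioo 0 T ⊆ Ioi 0)]
  · linarith
  · intro t ht
    rw [hA' t, zero_mul]
    exact fun h => ht.2 ⟨ht.1, h.2.trans_le ht₁⟩

/-- Away from the part of the cylinder reached from the lateral boundary, a weak solution is
transported from the initial data. -/
theorem ae_eq_initial {U₀ : ℝ → ℝ} (hUm : Measurable U) (hUC : ∀ p, |U p| ≤ C)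
    (hU₀m : Measurable U₀) (hU₀C : ∀ x, |U₀ x| ≤ C)
    (hU : IsWeakSolution T (fun v => b * v) U₀ U) :
    ∀ᵐ p : ℝ × ℝ, p ∈ cylinder T → p.2 - b * p.1 ∈ Omega → U p = U₀ (p.2 - b * p.1) := by
  have key : ∀ᵐ q : ℝ × ℝ, q ∈ {q : ℝ × ℝ | q.1 ∈ Ioo 0 T ∧ q.2 ∈ Omega ∧ q.2 + b * q.1 ∈ Omega} →
      U (q.1, q.2 + b * q.1) - U₀ q.2 = 0 := by
    -- The rectangle around `q` is chosen thin enough in `y` that its characteristics stay in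
    -- `Omega` from slightly before time `0` until slightly after time `q.1`.
    refine ae_cylinder_of_forall_mem_nhds fun q ⟨⟨hq0, hqT⟩, hq1, hq2⟩ => ?_
    have hopen : IsOpen {z : ℝ × ℝ | z.2 ∈ Omega ∧ z.2 + b * z.1 ∈ Omega ∧ z.1 < T} :=
      (isOpen_Ioo.preimage continuous_snd).inter
        ((isOpen_Ioo.preimage (by fun_prop : Continuous fun z : ℝ × ℝ => z.2 + b * z.1)).inter
          (isOpen_Iio.preimage continuous_fst))
    have n1 : {z : ℝ × ℝ | z.2 ∈ Omega ∧ z.2 + b * z.1 ∈ Omega ∧ z.1 < T} ∈ 𝓝 q :=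
      hopen.mem_nhds ⟨hq1, hq2, hqT⟩
    have n2 : {z : ℝ × ℝ | z.2 ∈ Omega ∧ z.2 + b * z.1 ∈ Omega ∧ z.1 < T} ∈ 𝓝 ((0 : ℝ), q.2) :=
      hopen.mem_nhds ⟨hq1, by simpa using hq1, hq0.trans hqT⟩
    obtain ⟨ε₁, hε₁, h₁⟩ := Metric.mem_nhds_iff.1 n1
    obtain ⟨ε₂, hε₂, h₂⟩ := Metric.mem_nhds_iff.1 n2
    set ε := min ε₁ ε₂ with hε
    have hεpos : 0 < ε := lt_min hε₁ hε₂
    have hle1 : ε ≤ ε₁ := min_le_left _ _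
    have hle2 : ε ≤ ε₂ := min_le_right _ _
    refine ⟨Ioo 0 (q.1 + ε / 2), Ioo (q.2 - ε) (q.2 + ε), isOpen_Ioo, isOpen_Ioo,
      ⟨⟨hq0, by linarith⟩, by linarith, by linarith⟩, ?_⟩
    have a1 : ∀ t y, |t - q.1| < ε → |y - q.2| < ε →
        y ∈ Omega ∧ y + b * t ∈ Omega ∧ t < T := by
      intro t y ht hy
      refine h₁ (show (t, y) ∈ _ from ?_)
      rw [Metric.mem_ball, Prod.dist_eq]
      exact max_lt (ht.trans_le hle1) (hy.trans_le hle1)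
    have a2 : ∀ t y, |t| < ε → |y - q.2| < ε →
        y ∈ Omega ∧ y + b * t ∈ Omega ∧ t < T := by
      intro t y ht hy
      refine h₂ (show (t, y) ∈ _ from ?_)
      rw [Metric.mem_ball, Prod.dist_eq]
      exact max_lt (by simpa [Real.dist_eq] using ht.trans_le hle2) (hy.trans_le hle2)
    refine ae_eq_initial_on_prod hUm hUC hU₀m hU₀C hU (t₀ := -(ε / 2)) (by linarith) ?_ isOpen_Ioo ?_
    · refine (a1 (q.1 + ε / 2) q.2 ?_ (by simpa using hεpos)).2.2.le
      rw [abs_lt]; constructor <;> linarith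
    · intro t ht y hy
      have hy' : |y - q.2| < ε := by rw [abs_lt]; constructor <;> linarith [hy.1, hy.2]
      rcases le_or_gt t 0 with h | h
      · exact (a2 t y (by rw [abs_lt]; constructor <;> linarith [ht.1]) hy').2.1
      · rcases le_or_gt q.1 t with h' | h'
        · exact (a1 t y (by rw [abs_lt]; constructor <;> linarith [ht.2]) hy').2.1
        -- At intermediate times `y + b * t` lies between its positions at times `0` and `q.1`, both
        -- in the interval `Omega`.
        · have b0 := (a2 0 y (by simpa using hεpos) hy').2.1
          have b1 := (a1 q.1 y (by simpa using hεpos) hy').2.1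
          simp only [mul_zero, add_zero, Omega, mem_Ioo] at b0 b1
          rcases le_total 0 b with hb | hb
          · have := mul_le_mul_of_nonneg_left h'.le hb
            have := mul_nonneg hb h.le
            exact ⟨by linarith, by linarith⟩
          · have := mul_le_mul_of_nonpos_left h'.le hb
            have := mul_nonpos_of_nonpos_of_nonneg hb h.le
            exact ⟨by linarith, by linarith⟩
  filter_upwards [(measurePreserving_shear b).quasiMeasurePreserving.ae key] with p hp hpc hpΩ
  have := hp ⟨hpc.1, hpΩ, by simpa using hpc.2⟩
  simpa [sub_eq_zero] using this


/-! ### Transport from the inflow boundary. -/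

/-- Right neighbourhoods have positive measure. This makes one-sided essential limits unique. -/
instance neBot_nhdsGT_inf_ae (a : ℝ) : (𝓝[>] a ⊓ ae (volume : Measure ℝ)).NeBot := by
  rw [inf_neBot_iff]
  intro s hs s' hs'
  obtain ⟨c, hc, hcs⟩ := mem_nhdsGT_iff_exists_Ioo_subset.1 hs
  by_contra h
  rw [not_nonempty_iff_eq_empty] at h
  have : volume (Ioo a c) = 0 := by
    refine measure_mono_null (fun x hx => ?_) (mem_ae_iff.1 hs')
    intro hx'
    have : x ∈ s ∩ s' := ⟨hcs hx, hx'⟩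
    rw [h] at this
    exact this
  simp [not_le.2 (mem_Ioi.1 hc)] at this

/-- In the part of the cylinder reached from the inflow boundary, a weak solution is transported
from its weak trace: local version. The coordinates are the travel time from the boundary point `e`
and the time of entry. -/
theorem ae_eq_inflow_on_prod {U₀ g : ℝ → ℝ} {e κ τ₁ τ₂ : ℝ} {l : Filter ℝ} (hUm : Measurable U)
    (hUC : ∀ p, |U p| ≤ C) (hgm : Measurable g) (hgC : ∀ t, |g t| ≤ C)
    (hU : IsWeakSolution T (fun v => b * v) U₀ U) (hb : b ≠ 0)
    (hΩ : ∀ σ, e + b * σ ∈ Omega ↔ σ ∈ Ioo 0 |b|⁻¹)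
    (hl : Tendsto (fun σ => e + b * σ) (𝓝[>] 0) l) (htr : HasWeakTrace T l U g)
    (hT : 0 < T) (hκ : 0 < κ) (hκb : κ ≤ |b|⁻¹) (hτ₁ : 0 < τ₁) (hτ₂ : τ₂ + κ ≤ T) :
    ∀ᵐ p : ℝ × ℝ, p ∈ Ioo 0 κ ×ˢ Ioo τ₁ τ₂ → U (p.2 + p.1, e + b * p.1) - g p.2 = 0 := by
  have hFm : Measurable (Function.uncurry fun σ τ => U (τ + σ, e + b * σ) - g τ) :=
    (hUm.comp (by fun_prop)).sub (hgm.comp measurable_snd)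
  have hFC : ∀ σ τ, |U (τ + σ, e + b * σ) - g τ| ≤ 2 * C := fun σ τ =>
    (abs_sub _ _).trans (by linarith [hUC (τ + σ, e + b * σ), hgC τ])
  refine ae_eq_zero_on_prod_of_forall_test hFm hFC isOpen_Ioo isOpen_Ioo ?_
  intro β hβ hβc hβJ
  have iβ : Integrable β := hβ.continuous.integrable_of_hasCompactSupport hβc
  have hβ0 : ∀ τ, τ ∉ Ioo τ₁ τ₂ → β τ = 0 := fun y hy =>
    image_eq_zero_of_notMem_tsupport fun h => hy (hβJ h)
  have hGm : Measurable (Function.uncurry fun σ τ => U (τ + σ, e + b * σ)) :=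
    hUm.comp (by fun_prop)
  -- The weak formulation makes `M` almost everywhere constant on `(0, κ)`; the weak trace
  -- identifies the constant through the essential limit `σ → 0+`.
  set M : ℝ → ℝ := fun σ => ∫ τ, U (τ + σ, e + b * σ) * β τ with hM
  have hconst := ae_eq_const_of_integral_mul_deriv_eq_zero (M := M) (a := 0) (c := κ)
    (locallyIntegrable_integral_mul hGm (fun σ τ => hUC _) hβ.continuous.measurable iβ) ?_
  · obtain ⟨m, hm⟩ := hconst
    have hlim : Tendsto M (𝓝[>] 0 ⊓ ae volume) (𝓝 (∫ t in Ioo 0 T, g t * β t)) := by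
      have hqmp : Tendsto (fun σ => e + b * σ) (ae volume) (ae volume) := by
        refine Measure.QuasiMeasurePreserving.tendsto_ae ?_
        exact (measurePreserving_add_left volume e).quasiMeasurePreserving.comp
          ⟨by fun_prop, by
            rw [Real.map_volume_mul_left hb]; exact Measure.smul_absolutelyContinuous⟩
      have h1 := (htr β hβ hβc (hβJ.trans (Ioo_subset_Ioo hτ₁.le (by linarith)))).comp
        (((hl.mono_left inf_le_left).inf (hqmp.mono_left inf_le_right)).mono_left
          (le_inf le_rfl le_rfl))
      obtain ⟨K, hK⟩ := ContDiff.lipschitzWith_of_hasCompactSupport hβc hβ (by simp)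
      -- `M σ` pairs the slice at `e + b * σ` with `β (t - σ)`, the trace condition with `β t`. As
      -- `β` is Lipschitz, the discrepancy is `O(σ)`.
      have h2 : ∀ᶠ σ in 𝓝[>] 0 ⊓ ae volume,
          ‖M σ - ∫ t in Ioo 0 T, U (t, e + b * σ) * β t‖ ≤ C * K * T * σ := by
        refine Eventually.filter_mono inf_le_left ?_
        filter_upwards [Ioo_mem_nhdsGT hκ] with σ hσ
        have e1 : M σ = ∫ t in Ioo 0 T, U (t, e + b * σ) * β (t - σ) := by
          rw [setIntegral_eq_integral_of_forall_compl_eq_zero, ← integral_add_right_eq_self _ σ]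
          · simp [hM]
          · intro t ht
            rw [hβ0, mul_zero]
            exact fun h => ht ⟨by linarith [h.1, hσ.1], by linarith [h.2, hσ.2]⟩
        have i1 : Integrable fun t => U (t, e + b * σ) * β (t - σ) :=
          (iβ.comp_sub_right σ).bdd_mul (hUm.comp (by fun_prop)).aestronglyMeasurable
            (.of_forall fun t => hUC _)
        have i2 : Integrable fun t => U (t, e + b * σ) * β t :=
          iβ.bdd_mul (hUm.comp (by fun_prop)).aestronglyMeasurable (.of_forall fun t => hUC _)
        rw [e1, ← integral_sub i1.integrableOn i2.integrableOn]
        have hC0 : 0 ≤ C := (abs_nonneg _).trans (hUC 0)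
        · refine (norm_setIntegral_le_of_norm_le_const (C := C * (K * σ)) (by simp)
            fun t _ => ?_).trans_eq ?_
          · rw [← mul_sub, norm_mul]
            refine mul_le_mul (hUC _) ?_ (norm_nonneg _) hC0
            have := hK.norm_sub_le (t - σ) t
            simpa [abs_of_pos hσ.1] using this
          · rw [Real.volume_real_Ioo_of_le hT.le]; ring
      have h3 : Tendsto (fun σ : ℝ => C * K * T * σ) (𝓝[>] 0 ⊓ ae volume) (𝓝 0) := by
        have : Tendsto (fun σ : ℝ => C * K * T * σ) (𝓝 0) (𝓝 (C * K * T * 0)) :=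
          (continuous_const.mul continuous_id).tendsto 0
        rw [mul_zero] at this
        exact this.mono_left (inf_le_left.trans nhdsWithin_le_nhds)
      have h4 := (squeeze_zero_norm' h2 h3).add h1
      simpa using h4
    have hm' : ∀ᶠ σ in 𝓝[>] 0 ⊓ ae volume, M σ = m := by
      have h1 : ∀ᶠ σ in 𝓝[>] (0 : ℝ) ⊓ ae volume, σ ∈ Ioo 0 κ :=
        Eventually.filter_mono inf_le_left (Ioo_mem_nhdsGT hκ)
      have h2 : ∀ᶠ σ in 𝓝[>] (0 : ℝ) ⊓ ae volume, σ ∈ Ioo 0 κ → M σ = m :=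
        Eventually.filter_mono inf_le_right hm
      filter_upwards [h1, h2] with σ h h' using h' h
    have hmg : m = ∫ t in Ioo 0 T, g t * β t :=
      tendsto_nhds_unique (tendsto_const_nhds.congr' (hm'.mono fun _ h => h.symm)) hlim
    rw [setIntegral_eq_integral_of_forall_compl_eq_zero] at hmg
    · filter_upwards [hm] with σ hσ hσI
      simp_rw [sub_mul]
      rw [integral_sub]
      · rw [← hmg]
        exact sub_eq_zero.2 (hσ hσI)
      · exact iβ.bdd_mul (hUm.comp (by fun_prop)).aestronglyMeasurable (.of_forall fun t => hUC _)
      · exact iβ.bdd_mul hgm.aestronglyMeasurable (.of_forall hgC)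
    · intro t ht
      rw [hβ0, mul_zero]
      exact fun h => ht ⟨by linarith [h.1], by linarith [h.2]⟩
  intro A hA hAc hAI
  have hA' : ∀ s, s ∉ Ioo 0 κ → deriv A s = 0 := fun s hs =>
    image_eq_zero_of_notMem_tsupport fun h => hs (hAI (tsupport_deriv_subset h))
  have hΨL : ∀ p : ℝ × ℝ, (fun q : ℝ × ℝ => (q.2 + q.1, e + b * q.1))
      ((p.2 - e) / b, p.1 - (p.2 - e) / b) = p := by
    intro p
    refine Prod.ext (by simp) ?_
    simp only
    field_simp
    ring
  have hxΩ : ∀ x, (x - e) / b ∈ Ioo 0 |b|⁻¹ ↔ x ∈ Omega := by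
    intro x
    rw [← hΩ]
    have : e + b * ((x - e) / b) = x := by field_simp; ring
    rw [this]
  have hφ : IsTestFunction T (fun p => A ((p.2 - e) / b) * β (p.1 - (p.2 - e) / b)) :=
    IsTestFunction.comp_mul_comp (L := fun p => (p.2 - e) / b) (N := fun p => p.1 - (p.2 - e) / b)
      (Ψ := fun q => (q.2 + q.1, e + b * q.1)) hA hAc hβ hβc (by fun_prop) (by fun_prop)
      (by fun_prop) hΨL (fun a ha c hc => by
        have h1 := hAI ha
        have h2 := hβJ hc
        refine ⟨?_, (hΩ a).2 ⟨h1.1, h1.2.trans_le hκb⟩⟩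
        simp only [mem_Iio]
        linarith [h1.2, h2.2])
  have hw := hU.weak_form _ hφ
  have hL' : ∀ p : ℝ × ℝ, HasFDerivAt (fun p : ℝ × ℝ => (p.2 - e) / b)
      (b⁻¹ • ContinuousLinearMap.snd ℝ ℝ ℝ) p := by
    intro p
    have := ((hasFDerivAt_snd (𝕜 := ℝ) (E := ℝ) (F := ℝ) (p := p)).sub_const e).const_mul b⁻¹
    simpa only [div_eq_inv_mul] using this
  have e1 : ∀ p : ℝ × ℝ, dt (fun p => A ((p.2 - e) / b) * β (p.1 - (p.2 - e) / b)) p * U p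
      + dx (fun p => A ((p.2 - e) / b) * β (p.1 - (p.2 - e) / b)) p * (b * U p)
      = deriv A ((p.2 - e) / b) * β (p.1 - (p.2 - e) / b) * U p := fun p =>
    dt_mul_add_dx_mul_comp_mul_comp (L := fun p => (p.2 - e) / b)
      (N := fun p => p.1 - (p.2 - e) / b) hA hβ (hL' p) (hasFDerivAt_fst.sub (hL' p))
      (by simp [hb]) (by simp [hb]) _
  simp_rw [e1] at hw
  -- Points of `Omega` at time `0` have negative entry time, outside the support of `β`, so the
  -- initial data do not contribute.
  have e2 : ∫ x in Omega, U₀ x * (A ((x - e) / b) * β (0 - (x - e) / b)) = 0 := by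
    rw [setIntegral_congr_fun (s := Omega) (g := fun _ => (0 : ℝ)) measurableSet_Ioo]
    · simp
    · intro x hx
      have := ((hxΩ x).2 hx).1
      simp only
      rw [hβ0, mul_zero, mul_zero]
      exact fun h => by linarith [h.1]
  rw [e2, add_zero] at hw
  have hint : IntegrableOn
      (fun p : ℝ × ℝ => deriv A ((p.2 - e) / b) * β (p.1 - (p.2 - e) / b) * U p)
      (Ioo 0 T ×ˢ Omega) (volume.prod volume) := by
    have hc : HasCompactSupport
        fun p : ℝ × ℝ => deriv A ((p.2 - e) / b) * β (p.1 - (p.2 - e) / b) :=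
      hasCompactSupport_comp_mul_comp (L := fun p => (p.2 - e) / b)
        (N := fun p => p.1 - (p.2 - e) / b)
        (Ψ := fun q => (q.2 + q.1, e + b * q.1)) hAc.deriv hβc (by fun_prop) hΨL
    have hcont : Continuous fun p : ℝ × ℝ =>
        deriv A ((p.2 - e) / b) * β (p.1 - (p.2 - e) / b) :=
      ((hA.continuous_deriv (by simp)).comp (by fun_prop)).mul (hβ.continuous.comp (by fun_prop))
    exact ((hcont.integrable_of_hasCompactSupport hc).mul_bdd hUm.aestronglyMeasurable
      (.of_forall hUC)).integrableOn
  rw [IntegrableOn, ← Measure.prod_restrict] at hint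
  rw [cylinder, Measure.volume_eq_prod, ← Measure.prod_restrict, integral_prod_symm _ hint] at hw
  have e3 : ∀ x, ∫ t in Ioo 0 T, deriv A ((x - e) / b) * β (t - (x - e) / b) * U (t, x)
      = deriv A ((x - e) / b) * M ((x - e) / b) := by
    intro x
    by_cases hx : (x - e) / b ∈ Ioo 0 κ
    · have e4 : e + b * ((x - e) / b) = x := by field_simp; ring
      rw [setIntegral_eq_integral_of_forall_compl_eq_zero,
        ← integral_add_right_eq_self _ ((x - e) / b), hM, ← integral_const_mul]
      · refine integral_congr_ae (.of_forall fun t => ?_)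
        simp only [add_sub_cancel_right, e4]; ring
      · intro t ht
        rw [hβ0, mul_zero, zero_mul]
        exact fun h => ht ⟨by linarith [h.1, hx.1], by linarith [h.2, hx.2]⟩
    · simp [hA' _ hx]
  simp only [e3] at hw
  rw [setIntegral_eq_integral_of_forall_compl_eq_zero,
    integral_sub_right_eq_self (fun x => deriv A (x / b) * M (x / b)) e,
    Measure.integral_comp_div (fun σ => deriv A σ * M σ) b, smul_eq_mul, mul_eq_zero] at hw
  · exact hw.resolve_left (abs_ne_zero.2 hb)
  · intro x hx
    rw [hA' _ fun h => hx ((hxΩ x).1 ⟨h.1, h.2.trans_le hκb⟩), zero_mul]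

/-- In the part of the cylinder reached from the inflow boundary, a weak solution is transported
from its weak trace. -/
theorem ae_eq_inflow {U₀ g : ℝ → ℝ} {e : ℝ} {l : Filter ℝ} (hUm : Measurable U)
    (hUC : ∀ p, |U p| ≤ C) (hgm : Measurable g) (hgC : ∀ t, |g t| ≤ C)
    (hU : IsWeakSolution T (fun v => b * v) U₀ U) (hb : b ≠ 0)
    (hΩ : ∀ σ, e + b * σ ∈ Omega ↔ σ ∈ Ioo 0 |b|⁻¹)
    (hl : Tendsto (fun σ => e + b * σ) (𝓝[>] 0) l) (htr : HasWeakTrace T l U g) :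
    ∀ᵐ p : ℝ × ℝ, p ∈ cylinder T → 0 < p.1 - (p.2 - e) / b →
      U p = g (p.1 - (p.2 - e) / b) := by
  have key : ∀ᵐ q : ℝ × ℝ, q ∈ {q : ℝ × ℝ | q.1 ∈ Ioo 0 |b|⁻¹ ∧ 0 < q.2 ∧ q.2 + q.1 < T} →
      U (q.2 + q.1, e + b * q.1) - g q.2 = 0 := by
    refine ae_cylinder_of_forall_mem_nhds fun q ⟨⟨h0, h1⟩, h2, h3⟩ => ?_
    obtain ⟨ε, hε, hε'⟩ : ∃ ε, 0 < ε ∧ ε < (T - (q.2 + q.1)) / 2 :=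
      exists_between (by linarith)
    refine ⟨Ioo 0 (min (q.1 + ε) |b|⁻¹), Ioo (q.2 / 2) (q.2 + ε), isOpen_Ioo, isOpen_Ioo,
      ⟨⟨h0, lt_min (by linarith) h1⟩, by linarith, by linarith⟩, ?_⟩
    refine ae_eq_inflow_on_prod hUm hUC hgm hgC hU hb hΩ hl htr (by linarith)
      (lt_min (by linarith) (h0.trans h1)) (min_le_right _ _) (by linarith) ?_
    linarith [min_le_left (q.1 + ε) |b|⁻¹]
  have hqmp : Measure.QuasiMeasurePreserving
      (fun p : ℝ × ℝ => ((p.2 - e) / b, p.1 - (p.2 - e) / b)) := by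
    have h1 : Measure.QuasiMeasurePreserving (fun x : ℝ => (x - e) / b) := by
      refine Measure.QuasiMeasurePreserving.comp (f := fun x => x - e) (g := fun x => x / b)
        (μb := volume) ⟨by fun_prop, ?_⟩
        (measurePreserving_sub_right volume e).quasiMeasurePreserving
      simp_rw [div_eq_mul_inv]
      rw [Real.map_volume_mul_right (inv_ne_zero hb)]
      exact Measure.smul_absolutelyContinuous
    have h2 : Measure.QuasiMeasurePreserving (fun p : ℝ × ℝ => (p.1, (p.2 - e) / b))
        (volume.prod volume) (volume.prod volume) :=
      MeasureTheory.QuasiMeasurePreserving.prodMap (.id volume) h1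
    have h3 := (measurePreserving_shear 1).quasiMeasurePreserving.comp
      ((Measure.measurePreserving_swap (μ := volume) (ν := volume)).quasiMeasurePreserving.comp h2)
    simp only [Function.comp_def, Prod.swap, one_mul] at h3
    exact h3
  filter_upwards [hqmp.ae key] with p hp hpc hp0
  have e4 : e + b * ((p.2 - e) / b) = p.2 := by field_simp; ring
  have := hp ⟨(hΩ _).1 (by rw [e4]; exact hpc.2), hp0, by simpa using hpc.1.2⟩
  simp only [e4, sub_add_cancel] at this
  exact sub_eq_zero.1 this


/-! ### Good representatives. -/

/-- Truncation of a measurable representative at the essential supremum. Measurability and the bound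
then hold everywhere, hence also on every slice and after every change of variables. -/
theorem exists_measurable_bounded_ae_eq {α : Type*} [MeasurableSpace α] {μ : Measure α}
    {f : α → ℝ} (hf : MemLp f ∞ μ) :
    ∃ (g : α → ℝ) (C : ℝ), Measurable g ∧ (∀ x, |g x| ≤ C) ∧ f =ᵐ[μ] g := by
  set C := (eLpNorm f ∞ μ).toReal with hC
  have hC0 : 0 ≤ C := ENNReal.toReal_nonneg
  refine ⟨fun x => max (-C) (min C (hf.1.mk f x)), C, ?_, fun x => ?_, ?_⟩
  · exact measurable_const.max (measurable_const.min hf.1.stronglyMeasurable_mk.measurable)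
  · exact abs_le.2 ⟨le_max_left _ _, max_le (by linarith) (min_le_left _ _)⟩
  · filter_upwards [hf.1.ae_eq_mk, ae_le_eLpNormEssSup (f := f) (μ := μ)] with x hx hxC
    rw [← hx]
    have h1 : ‖f x‖ ≤ C := by
      rw [hC, ← toReal_enorm]
      refine ENNReal.toReal_mono hf.2.ne ?_
      rwa [eLpNorm_exponent_top]
    have h2 := abs_le.1 h1
    rw [min_eq_right h2.2, max_eq_right h2.1]

theorem IsWeakSolution.congr {f : ℝ → ℝ} {u₀ U₀ : ℝ → ℝ} {u : ℝ × ℝ → ℝ}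
    (hu : IsWeakSolution T f u₀ u) (h : u =ᵐ[volume.restrict (cylinder T)] U)
    (h₀ : u₀ =ᵐ[volume.restrict Omega] U₀) : IsWeakSolution T f U₀ U where
  memLp_top := hu.memLp_top.ae_eq h
  weak_form φ hφ := by
    refine Eq.trans ?_ (hu.weak_form φ hφ)
    symm
    congr 1
    · refine integral_congr_ae ?_
      filter_upwards [h] with p hp
      rw [hp]
    · refine integral_congr_ae ?_
      filter_upwards [h₀] with x hx
      simp only [hx]

/-- By Fubini, almost every slice in `x` is unchanged up to null sets of `t`, and the essential
limit ignores the remaining `x`. -/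
theorem HasWeakTrace.congr {l : Filter ℝ} {u : ℝ × ℝ → ℝ} {g G : ℝ → ℝ}
    (hu : HasWeakTrace T l u g) (h : u =ᵐ[volume.restrict (cylinder T)] U)
    (hl : ∀ᶠ x in l, x ∈ Omega) (hg : EqOn g G (Ioo 0 T)) : HasWeakTrace T l U G := by
  intro ψ h1 h2 h3
  have h4 := hu ψ h1 h2 h3
  rw [setIntegral_congr_fun (g := fun t => G t * ψ t) measurableSet_Ioo
    (fun t ht => by simp only [hg ht])] at h4
  refine h4.congr' ?_
  have h5 : ∀ᵐ x ∂(volume.restrict Omega), ∀ᵐ t ∂(volume.restrict (Ioo 0 T)),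
      u (t, x) = U (t, x) := by
    rw [cylinder, Measure.volume_eq_prod, ← Measure.prod_restrict] at h
    exact Measure.ae_ae_of_ae_prod (Measure.measurePreserving_swap.quasiMeasurePreserving.ae h :
      ∀ᵐ q : ℝ × ℝ ∂((volume.restrict Omega).prod (volume.restrict (Ioo 0 T))),
        u (q.2, q.1) = U (q.2, q.1))
  have h6 : ∀ᶠ x in l ⊓ ae volume, x ∈ Omega := hl.filter_mono inf_le_left
  have h7 : ∀ᶠ x in l ⊓ ae volume, x ∈ Omega → ∀ᵐ t ∂(volume.restrict (Ioo 0 T)),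
      u (t, x) = U (t, x) :=
    Eventually.filter_mono inf_le_right ((ae_restrict_iff' measurableSet_Ioo).1 h5)
  filter_upwards [h6, h7] with x hx hx'
  refine integral_congr_ae ?_
  filter_upwards [hx' hx] with t ht
  rw [ht]

/-! ### Error bounds: pointwise along characteristics, then in `L²`. -/

theorem enorm_intervalIntegral_le {f : ℝ → ℝ} {s t : ℝ} (hst : s ≤ t) :
    ‖∫ r in s..t, f r‖ₑ ≤ ∫⁻ r in Ioo s t, ‖f r‖ₑ := by
  rw [intervalIntegral.integral_of_le hst, ← restrict_Ioo_eq_restrict_Ioc]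
  exact enorm_integral_le_lintegral_enorm _

/-- The pointwise bound of the error by the error transported along characteristics from the
initial time and the residual accumulated along characteristics. -/
theorem ae_enorm_sub_le {U₀ : ℝ → ℝ} {v : ℝ × ℝ → ℝ} {K : ℝ≥0} (hv : LipschitzWith K v)
    (h₀ : ∀ᵐ p : ℝ × ℝ, p ∈ cylinder T → p.2 - b * p.1 ∈ Omega → U p = U₀ (p.2 - b * p.1))
    (h₁ : b ≠ 0 → ∃ e, (∀ σ, e + b * σ ∈ Omega ↔ σ ∈ Ioo 0 |b|⁻¹) ∧
      ∀ᵐ p : ℝ × ℝ, p ∈ cylinder T → 0 < p.1 - (p.2 - e) / b →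
        U p = v (p.1 - (p.2 - e) / b, e)) :
    ∀ᵐ p : ℝ × ℝ, p ∈ cylinder T →
      ‖U p - v p‖ₑ ≤ Omega.indicator (fun y => ‖U₀ y - v (0, y)‖ₑ) (p.2 - b * p.1) +
        ∫⁻ s in Ioo 0 p.1, Omega.indicator (fun y => ‖fderiv ℝ v (s, y) (1, b)‖ₑ)
          (p.2 - b * (p.1 - s)) := by
  have hA : ∀ᵐ p : ℝ × ℝ, p ∈ cylinder T → p.2 - b * p.1 ∈ Omega →
      ‖U p - v p‖ₑ ≤ Omega.indicator (fun y => ‖U₀ y - v (0, y)‖ₑ) (p.2 - b * p.1) +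
        ∫⁻ s in Ioo 0 p.1, Omega.indicator (fun y => ‖fderiv ℝ v (s, y) (1, b)‖ₑ)
          (p.2 - b * (p.1 - s)) := by
    filter_upwards [h₀, ae_sub_eq_integral_along_characteristic hv b] with p hp hc hpc hpΩ
    have h1 := hc 0
    rw [sub_zero] at h1
    have h2 : U p - v p = (U₀ (p.2 - b * p.1) - v (0, p.2 - b * p.1))
        - ∫ r in 0..p.1, fderiv ℝ v (r, p.2 - b * (p.1 - r)) (1, b) := by
      rw [← h1, hp hpc hpΩ]; ring
    rw [h2, indicator_of_mem hpΩ]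
    refine enorm_sub_le.trans (add_le_add le_rfl ?_)
    refine (enorm_intervalIntegral_le hpc.1.1.le).trans ?_
    refine setLIntegral_mono' measurableSet_Ioo fun s hs => ?_
    rw [indicator_of_mem]
    have hx := hpc.2
    simp only [Omega, mem_Ioo] at hx hpΩ ⊢
    rcases le_total 0 b with hb | hb
    · have := mul_nonneg hb hs.1.le
      have := mul_nonneg hb (sub_nonneg.2 hs.2.le)
      constructor <;> linarith
    · have := mul_nonpos_of_nonpos_of_nonneg hb hs.1.le
      have := mul_nonpos_of_nonpos_of_nonneg hb (sub_nonneg.2 hs.2.le)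
      constructor <;> linarith
  rcases eq_or_ne b 0 with rfl | hb
  · filter_upwards [hA] with p hp hpc
    exact hp hpc (by simpa using hpc.2)
  obtain ⟨e, hΩ, he⟩ := h₁ hb
  -- The single characteristic through the corner `(0, e)` is null; all others have nonzero entry
  -- time `p.1 - σ`.
  have hne : ∀ᵐ p : ℝ × ℝ, p.2 - b * p.1 ≠ e :=
    (Measure.quasiMeasurePreserving_snd.comp
      (measurePreserving_shear b).quasiMeasurePreserving).ae (Measure.ae_ne volume e)
  filter_upwards [hA, he, hne, ae_sub_eq_integral_along_characteristic hv b]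
    with p hp hpe hpne hc hpc
  have hx : e + b * ((p.2 - e) / b) = p.2 := by field_simp; ring
  have hσ : (p.2 - e) / b ∈ Ioo 0 |b|⁻¹ := (hΩ _).1 (by rw [hx]; exact hpc.2)
  set σ := (p.2 - e) / b with hσdef
  rcases lt_trichotomy 0 (p.1 - σ) with hτ | hτ | hτ
  -- Entry through the boundary: `U` and `v` agree at the entry point, so only the residual since
  -- the entry time remains.
  · have h1 := hc (p.1 - σ)
    have h2 : p.2 - b * (p.1 - (p.1 - σ)) = e := by rw [← hx]; ring
    rw [h2] at h1
    have h3 : U p - v p = -∫ r in (p.1 - σ)..p.1, fderiv ℝ v (r, p.2 - b * (p.1 - r)) (1, b) := by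
      rw [← h1, hpe hpc hτ]; ring
    rw [h3, enorm_neg]
    refine le_add_left ?_
    refine (enorm_intervalIntegral_le (by linarith [hσ.1])).trans ?_
    refine le_trans ?_ (lintegral_mono_set (Ioo_subset_Ioo_left hτ.le))
    refine setLIntegral_mono' measurableSet_Ioo fun s hs => ?_
    rw [indicator_of_mem]
    have h4 : p.2 - b * (p.1 - s) = e + b * (s - (p.1 - σ)) := by rw [← hx]; ring
    rw [h4, hΩ]
    exact ⟨by linarith [hs.1], by linarith [hs.2, hσ.2]⟩
  · exact absurd (by rw [← hx]; linear_combination b * hτ) hpne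
  · refine hp hpc ?_
    have h4 : p.2 - b * p.1 = e + b * (σ - p.1) := by rw [← hx]; ring
    rw [h4, hΩ]
    exact ⟨by linarith, by linarith [hσ.2, hpc.1.1]⟩

theorem eLpNorm_indicator_enorm (w : ℝ → ℝ) :
    eLpNorm (Omega.indicator fun y => ‖w y‖ₑ) 2 volume = normL2 w := by
  rw [eLpNorm_indicator_eq_eLpNorm_restrict (s := Omega) measurableSet_Ioo, eLpNorm_enorm, normL2]

theorem eLpNorm_comp_sub_right {f : ℝ → ℝ≥0∞} (hf : Measurable f) (c : ℝ) :
    eLpNorm (fun x => f (x - c)) 2 volume = eLpNorm f 2 volume :=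
  eLpNorm_comp_measurePreserving (g := f) (f := fun x => x - c)
    hf.stronglyMeasurable.aestronglyMeasurable (measurePreserving_sub_right volume c)

/-- The `L²` norm of a function dominated by transported initial data and a transported residual. -/
theorem normL2_le_of_ae_enorm_le {w k : ℝ → ℝ} {R : ℝ × ℝ → ℝ} {t : ℝ} (hk : Measurable k)
    (hR : Measurable R)
    (h : ∀ᵐ x ∂(volume.restrict Omega),
      ‖w x‖ₑ ≤ Omega.indicator (fun y => ‖k y‖ₑ) (x - b * t) +
        ∫⁻ s in Ioo 0 t, Omega.indicator (fun y => ‖R (s, y)‖ₑ) (x - b * (t - s))) :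
    normL2 w ≤ normL2 k + ∫⁻ s in Ioo 0 t, normL2 (fun x => R (s, x)) := by
  have hkm : Measurable (Omega.indicator fun y => ‖k y‖ₑ) := hk.enorm.indicator measurableSet_Ioo
  have hRm : Measurable (Function.uncurry fun s x : ℝ =>
      Omega.indicator (fun y => ‖R (s, y)‖ₑ) (x - b * (t - s))) := by
    have : (Function.uncurry fun s x : ℝ =>
        Omega.indicator (fun y => ‖R (s, y)‖ₑ) (x - b * (t - s))) =
        {q : ℝ × ℝ | q.2 - b * (t - q.1) ∈ Omega}.indicator
          (fun q => ‖R (q.1, q.2 - b * (t - q.1))‖ₑ) := by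
      ext q
      simp [indicator, Function.uncurry_def]
    rw [this]
    refine Measurable.indicator (hR.comp (by fun_prop)).enorm ?_
    exact measurableSet_Ioo.preimage (by fun_prop)
  have hkm' : AEStronglyMeasurable (fun x => Omega.indicator (fun y => ‖k y‖ₑ) (x - b * t))
      volume := by
    have : Measurable fun x : ℝ => x - b * t := by fun_prop
    exact (hkm.comp this).stronglyMeasurable.aestronglyMeasurable
  have hRm' : AEStronglyMeasurable (fun x => ∫⁻ s in Ioo 0 t,
      Omega.indicator (fun y => ‖R (s, y)‖ₑ) (x - b * (t - s))) volume :=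
    (Measurable.lintegral_prod_left hRm).stronglyMeasurable.aestronglyMeasurable
  -- On the whole line translations preserve the `L²` norm, and the indicators keep the enlarged
  -- norms equal to norms over `Omega`.
  calc normL2 w ≤ eLpNorm (fun x => Omega.indicator (fun y => ‖k y‖ₑ) (x - b * t) +
        ∫⁻ s in Ioo 0 t, Omega.indicator (fun y => ‖R (s, y)‖ₑ) (x - b * (t - s))) 2
        (volume.restrict Omega) := eLpNorm_mono_enorm_ae (by simpa using h)
    _ ≤ eLpNorm (fun x => Omega.indicator (fun y => ‖k y‖ₑ) (x - b * t) +
        ∫⁻ s in Ioo 0 t, Omega.indicator (fun y => ‖R (s, y)‖ₑ) (x - b * (t - s))) 2 volume :=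
      eLpNorm_mono_measure _ Measure.restrict_le_self
    _ ≤ eLpNorm (fun x => Omega.indicator (fun y => ‖k y‖ₑ) (x - b * t)) 2 volume +
        eLpNorm (fun x => ∫⁻ s in Ioo 0 t,
          Omega.indicator (fun y => ‖R (s, y)‖ₑ) (x - b * (t - s))) 2 volume :=
      eLpNorm_add_le hkm' hRm' (by norm_num)
    _ ≤ eLpNorm (fun x => Omega.indicator (fun y => ‖k y‖ₑ) (x - b * t)) 2 volume +
        ∫⁻ s in Ioo 0 t, eLpNorm (fun x =>
          Omega.indicator (fun y => ‖R (s, y)‖ₑ) (x - b * (t - s))) 2 volume :=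
      add_le_add le_rfl (eLpNorm_two_lintegral_le hRm)
    _ = normL2 k + ∫⁻ s in Ioo 0 t, normL2 (fun x => R (s, x)) := by
      rw [← eLpNorm_indicator_enorm k]
      congr 1
      · exact eLpNorm_comp_sub_right hkm (b * t)
      · refine lintegral_congr fun s => ?_
        rw [← eLpNorm_indicator_enorm]
        exact eLpNorm_comp_sub_right
          ((hR.comp measurable_prodMk_left).enorm.indicator measurableSet_Ioo) (b * (t - s))

/-- A strong solution solves the equation in the form of a derivative in the characteristic
direction, for any differentiable extension to the plane. -/
theorem IsLipschitzSolution.ae_fderiv_eq {r v : ℝ × ℝ → ℝ} {v₀ : ℝ → ℝ} {u : ℝ × ℝ → ℝ} {K : ℝ≥0}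
    (hu : IsLipschitzSolution T (fun w => b * w) r v₀ u) (hv : LipschitzWith K v)
    (huv : EqOn u v (Icc 0 T ×ˢ Icc 0 1)) :
    ∀ᵐ p ∂(volume.restrict (cylinder T)), fderiv ℝ v p (1, b) = r p := by
  filter_upwards [hu.equation, ae_restrict_of_ae hv.ae_differentiableAt,
    ae_restrict_mem (measurableSet_cylinder T)] with p ⟨vt, vx, ht, hx, he⟩ hd hp
  have h1 : HasDerivAt (fun t => v (t, p.2)) vt p.1 := by
    refine ht.congr_of_eventuallyEq ?_
    filter_upwards [isOpen_Ioo.mem_nhds hp.1] with t ht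
    exact (huv (x := (t, p.2)) ⟨Ioo_subset_Icc_self ht, Ioo_subset_Icc_self hp.2⟩).symm
  have h2 : HasDerivAt (fun x => b * v (p.1, x)) vx p.2 := by
    refine hx.congr_of_eventuallyEq ?_
    filter_upwards [isOpen_Ioo.mem_nhds hp.2] with x hx
    rw [huv (x := (p.1, x)) ⟨Ioo_subset_Icc_self hp.1, Ioo_subset_Icc_self hx⟩]
  have h3 : HasDerivAt (fun t => v (t, p.2)) (fderiv ℝ v p (1, 0)) p.1 :=
    hd.hasFDerivAt.comp_hasDerivAt p.1 ((hasDerivAt_id p.1).prodMk (hasDerivAt_const p.1 p.2))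
  have h4 : HasDerivAt (fun x => v (p.1, x)) (fderiv ℝ v p (0, 1)) p.2 :=
    hd.hasFDerivAt.comp_hasDerivAt p.2 ((hasDerivAt_const p.2 p.1).prodMk (hasDerivAt_id p.2))
  have h5 : ((1 : ℝ), b) = (1, 0) + b • (0, 1) := by simp
  rw [h5, map_add, map_smul, smul_eq_mul, h3.unique h1, (h4.const_mul b).unique h2, he]

/-- The inflow endpoint, with travel times from it as a coordinate on the domain. -/
theorem exists_inflow_endpoint {u uhat : ℝ × ℝ → ℝ} {g : ℝ → ℝ} (hb : b ≠ 0)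
    (hu : AttainsInflowData T b u g) (huhat : AttainsInflowDataPointwise T b uhat g) :
    ∃ (e : ℝ) (l : Filter ℝ), e ∈ Icc (0 : ℝ) 1 ∧
      (∀ σ, e + b * σ ∈ Omega ↔ σ ∈ Ioo 0 |b|⁻¹) ∧ (∀ᶠ x in l, x ∈ Omega) ∧
      Tendsto (fun σ => e + b * σ) (𝓝[>] 0) l ∧ HasWeakTrace T l u g ∧
      ∀ t ∈ Ioo 0 T, uhat (t, e) = g t := by
  have hlim : ∀ e : ℝ, Tendsto (fun σ => e + b * σ) (𝓝[>] 0) (𝓝 e) := by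
    intro e
    have : Tendsto (fun σ => e + b * σ) (𝓝 0) (𝓝 (e + b * 0)) :=
      (by fun_prop : Continuous fun σ => e + b * σ).tendsto 0
    rw [mul_zero, add_zero] at this
    exact this.mono_left nhdsWithin_le_nhds
  rcases hb.lt_or_gt with hb | hb
  · refine ⟨1, 𝓝[<] 1, by simp, fun σ => ?_, Ioo_mem_nhdsLT one_pos, ?_, hu.2 hb, huhat.2 hb⟩
    · have h : σ < |b|⁻¹ ↔ -b * σ < 1 := by
        rw [abs_of_neg hb, ← one_div, lt_div_iff₀ (neg_pos.2 hb), mul_comm]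
      rw [mem_Ioo, h, Omega, mem_Ioo]
      constructor <;> rintro ⟨h1, h2⟩
      · exact ⟨by nlinarith, by linarith⟩
      · exact ⟨by linarith, by nlinarith⟩
    · refine tendsto_nhdsWithin_iff.2 ⟨hlim 1, ?_⟩
      filter_upwards [self_mem_nhdsWithin] with σ hσ
      have := mul_neg_of_neg_of_pos hb (mem_Ioi.1 hσ)
      exact mem_Iio.2 (by linarith)
  · refine ⟨0, 𝓝[>] 0, by simp, fun σ => ?_, Ioo_mem_nhdsGT one_pos, ?_, hu.1 hb, huhat.1 hb⟩
    · have h : σ < |b|⁻¹ ↔ b * σ < 1 := by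
        rw [abs_of_pos hb, ← one_div, lt_div_iff₀ hb, mul_comm]
      rw [mem_Ioo, h, Omega, mem_Ioo, zero_add, mul_pos_iff_of_pos_left hb]
    · refine tendsto_nhdsWithin_iff.2 ⟨hlim 0, ?_⟩
      filter_upwards [self_mem_nhdsWithin] with σ hσ
      have := mul_pos hb (mem_Ioi.1 hσ)
      exact mem_Ioi.2 (by linarith)

/-! ### Assembly of the bound. -/

/-- Since `(x + y)² ≤ 2 (x² + y²)`, the factor `1 / 2` would already do. -/
theorem quarter_mul_add_sq_le (x y : ℝ≥0∞) : 1 / 4 * (x + y) ^ 2 ≤ x ^ 2 + y ^ 2 := by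
  rcases eq_or_ne x ⊤ with rfl | hx
  · simp
  rcases eq_or_ne y ⊤ with rfl | hy
  · simp
  lift x to ℝ≥0 using hx
  lift y to ℝ≥0 using hy
  have h : (1 / 4 : ℝ≥0) * (x + y) ^ 2 ≤ x ^ 2 + y ^ 2 := by
    rw [← NNReal.coe_le_coe]
    push_cast
    nlinarith [sq_nonneg ((x : ℝ) - y), sq_nonneg (x : ℝ), sq_nonneg (y : ℝ)]
  have h4 : (1 / 4 : ℝ≥0∞) = ((1 / 4 : ℝ≥0) : ℝ≥0∞) := by
    rw [ENNReal.coe_div (by norm_num)]; simp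
  rw [h4]
  exact_mod_cast h

/-- The relative entropy bound, by the method of characteristics. -/
theorem ae_normLinftyL2_sub_sq_le {u₀ uhat₀ g : ℝ → ℝ} {u uhat r₁ : ℝ × ℝ → ℝ} (hT : 0 < T)
    (hu₀ : MemLp u₀ ∞ (volume.restrict Omega)) (hu : IsWeakSolution T (fun v => b * v) u₀ u)
    (hu_bdry : AttainsInflowData T b u g)
    (huhat : IsLipschitzSolution T (fun v => b * v) r₁ uhat₀ uhat)
    (huhat_bdry : AttainsInflowDataPointwise T b uhat g) :
    ∀ᵐ t ∂(volume.restrict (Ioo 0 T)),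
      1 / 4 * normLinftyL2 t (fun p => u p - uhat p) ^ 2
        ≤ normL2 (fun x => u₀ x - uhat₀ x) ^ 2 + normL1L2 t r₁ ^ 2 := by
  obtain ⟨K, hK⟩ := huhat.lipschitz
  obtain ⟨v, hv, huv⟩ := hK.extend_real
  obtain ⟨U, C₁, hUm, hUC, hU⟩ := exists_measurable_bounded_ae_eq hu.memLp_top
  obtain ⟨U₀, C₂, hU₀m, hU₀C, hU₀⟩ := exists_measurable_bounded_ae_eq hu₀
  have hw : IsWeakSolution T (fun w => b * w) U₀ U := hu.congr hU hU₀
  have hvm : Measurable v := hv.continuous.measurable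
  -- `R` is a Borel version of the residual, defined on the whole plane through the Lipschitz
  -- extension `v`; it agrees with `r₁` almost everywhere on the cylinder.
  set R : ℝ × ℝ → ℝ := fun p => fderiv ℝ v p (1, b) with hR
  have hRm : Measurable R := measurable_fderiv_apply_const ℝ v (1, b)
  have hbound := ae_enorm_sub_le (T := T) (U₀ := U₀) hv
    (ae_eq_initial (C := max C₁ C₂) hUm (fun p => (hUC p).trans (le_max_left _ _)) hU₀m
      (fun x => (hU₀C x).trans (le_max_right _ _)) hw) (fun hb => by
    obtain ⟨e, l, he, hΩ, hlΩ, hl, htr, hge⟩ := exists_inflow_endpoint hb hu_bdry huhat_bdry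
    refine ⟨e, hΩ, ?_⟩
    -- The boundary values are cut off outside `(0, T)` to be bounded and measurable on all of `ℝ`;
    -- entry times of points of the cylinder are always below `T`.
    set G : ℝ → ℝ := (Ioo 0 T).indicator fun t => v (t, e) with hG
    obtain ⟨C₃, hC₃⟩ := (isCompact_Icc (a := 0) (b := T)).exists_bound_of_continuousOn
      (f := fun t => v (t, e)) (hv.continuous.comp (by fun_prop)).continuousOn
    have hGC : ∀ t, |G t| ≤ max C₁ C₃ := by
      intro t
      by_cases ht : t ∈ Ioo 0 T
      · rw [hG, indicator_of_mem ht]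
        exact (hC₃ t (Ioo_subset_Icc_self ht)).trans (le_max_right _ _)
      · rw [hG, indicator_of_notMem ht, abs_zero]
        exact ((abs_nonneg _).trans (hUC 0)).trans (le_max_left _ _)
    have hGm : Measurable G :=
      (hvm.comp (measurable_id.prodMk measurable_const)).indicator measurableSet_Ioo
    have hgG : EqOn g G (Ioo 0 T) := by
      intro t ht
      rw [hG, indicator_of_mem ht, ← hge t ht]
      exact huv (x := (t, e)) ⟨Ioo_subset_Icc_self ht, he⟩
    have := ae_eq_inflow hUm (fun p => (hUC p).trans (le_max_left _ _))
      hGm hGC hw hb hΩ hl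
      (htr.congr hU hlΩ hgG)
    filter_upwards [this] with p hp hpc hp0
    rw [hp hpc hp0, hG, indicator_of_mem]
    refine ⟨hp0, ?_⟩
    have : 0 < (p.2 - e) / b := ((hΩ _).1 (by
      have : e + b * ((p.2 - e) / b) = p.2 := by field_simp; ring
      rw [this]; exact hpc.2)).1
    linarith [hpc.1.2])
  have hslice : ∀ {P : ℝ × ℝ → Prop}, (∀ᵐ p ∂(volume.restrict (cylinder T)), P p) →
      ∀ᵐ t ∂(volume.restrict (Ioo 0 T)), ∀ᵐ x ∂(volume.restrict Omega), P (t, x) := by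
    intro P h
    rw [cylinder, Measure.volume_eq_prod, ← Measure.prod_restrict] at h
    exact Measure.ae_ae_of_ae_prod h
  have hk : normL2 (fun x => U₀ x - v (0, x)) = normL2 (fun x => u₀ x - uhat₀ x) := by
    refine eLpNorm_congr_ae ?_
    filter_upwards [hU₀, ae_restrict_mem measurableSet_Ioo] with x hx hxΩ
    rw [hx, ← huv (x := (0, x)) ⟨⟨le_rfl, hT.le⟩, Ioo_subset_Icc_self hxΩ⟩, huhat.initial x hxΩ]
  have hr : ∀ᵐ s ∂(volume.restrict (Ioo 0 T)),
      normL2 (fun x => R (s, x)) = normL2 (fun x => r₁ (s, x)) := by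
    filter_upwards [hslice (huhat.ae_fderiv_eq hv huv)] with s hs
    exact eLpNorm_congr_ae hs
  have hnorm : ∀ᵐ t ∂(volume.restrict (Ioo 0 T)),
      normL2 (fun x => u (t, x) - uhat (t, x))
        ≤ normL2 (fun x => u₀ x - uhat₀ x) + normL1L2 t r₁ := by
    filter_upwards [hslice hU, hslice ((ae_restrict_iff' (measurableSet_cylinder T)).2 hbound),
      ae_restrict_mem measurableSet_Ioo] with t htU htb ht
    have h1 : normL2 (fun x => u (t, x) - uhat (t, x)) = normL2 (fun x => U (t, x) - v (t, x)) := by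
      refine eLpNorm_congr_ae ?_
      filter_upwards [htU, ae_restrict_mem measurableSet_Ioo] with x hx hxΩ
      rw [hx, huv (x := (t, x)) ⟨Ioo_subset_Icc_self ht, Ioo_subset_Icc_self hxΩ⟩]
    have h2 : normL1L2 t r₁ = ∫⁻ s in Ioo 0 t, normL2 (fun x => R (s, x)) := by
      refine lintegral_congr_ae ?_
      filter_upwards [ae_restrict_of_ae_restrict_of_subset (Ioo_subset_Ioo_right ht.2.le) hr]
        with s hs using hs.symm
    rw [h1, h2, ← hk]
    exact normL2_le_of_ae_enorm_le (hU₀m.sub (hvm.comp (by fun_prop))) hRm htb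
  filter_upwards [ae_restrict_mem measurableSet_Ioo] with t ht
  have hsup : normLinftyL2 t (fun p => u p - uhat p)
      ≤ normL2 (fun x => u₀ x - uhat₀ x) + normL1L2 t r₁ := by
    refine essSup_le_of_ae_le _ ?_
    filter_upwards [ae_restrict_of_ae_restrict_of_subset (Ioo_subset_Ioo_right ht.2.le) hnorm,
      ae_restrict_mem measurableSet_Ioo] with s hs hst
    exact hs.trans (add_le_add le_rfl (lintegral_mono_set (Ioo_subset_Ioo_right hst.2.le)))
  calc 1 / 4 * normLinftyL2 t (fun p => u p - uhat p) ^ 2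
      ≤ 1 / 4 * (normL2 (fun x => u₀ x - uhat₀ x) + normL1L2 t r₁) ^ 2 := by gcongr
    _ ≤ _ := quarter_mul_add_sq_le _ _

end InviscidAdvection

theorem mainTheorem4 (T b : ℝ) (hT : 0 < T)
    (u₀ uhat₀ g : ℝ → ℝ) (u uhat r₁ : ℝ × ℝ → ℝ)
    (hu₀ : MemLp u₀ ∞ (volume.restrict InviscidAdvection.Omega))
    (hg : ∃ K : ℝ≥0, LipschitzOnWith K g (Ioo 0 T))
    (hu : InviscidAdvection.IsEntropySolution T (fun v => b * v)
      (fun v => 1 / 2 * v ^ 2) (fun v => b / 2 * v ^ 2) u₀ u)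
    (hu_bdry : InviscidAdvection.AttainsInflowData T b u g)
    (huhat₀ : ∃ K : ℝ≥0, LipschitzOnWith K uhat₀ InviscidAdvection.Omega)
    (hr₁ : InviscidAdvection.MemL1L2 T r₁)
    (huhat : InviscidAdvection.IsLipschitzSolution T (fun v => b * v) r₁ uhat₀ uhat)
    (huhat_bdry : InviscidAdvection.AttainsInflowDataPointwise T b uhat g) :
    ∀ᵐ t ∂(volume.restrict (Ioo 0 T)),
      1 / 4 * InviscidAdvection.normLinftyL2 t (fun p => u p - uhat p) ^ 2
        ≤ InviscidAdvection.normL2 (fun x => u₀ x - uhat₀ x) ^ 2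
          + InviscidAdvection.normL1L2 t r₁ ^ 2 :=
  InviscidAdvection.ae_normLinftyL2_sub_sq_le hT hu₀ hu.toIsWeakSolution hu_bdry huhat huhat_bdry
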